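/- **Setting.** Let $\mathcal X,\mathcal A$ be finite non-empty sets, $N,T\ge 1$, $\ell\ge 0$, $0\le\alpha<1$, $\Psi\ge 0$, $\delta\in(0,1)$, let $p=(p_n)_{n\in[N]}$ be a transition kernel and $\rho\in\Delta_{\mathcal X\times\mathcal A}$. For a kernel $q$, a policy $\pi=(\pi_n)_{n\in[N]}$ and a distribution $\nu$ on $\mathcal X\times\mathcal A$ let $\mu^{\pi,q,\nu}_0=\nu$ and $\mu^{\pi,q,\nu}_{n}(x,a)=\sum_{x',a'}\mu^{\pi,q,\nu}_{n-1}(x',a')\,q_{n}(x|x',a')\,\pi_{n}(a|x)$ for $n\in[N]$, and put $\nu P_\pi=\mu^{\pi,p,\nu}_N$. A policy $\pi$ is periodic if $\rho P_\pi=\rho$. Assume that $\|\nu P_\pi-\nu'P_\pi\|_1\le\alpha\|\nu-\nu'\|_1$ for all periodic $\pi$ and all distributions $\nu,\nu'$. **Observations.** Let $\rho_1=\rho$ and $\rho_{t+1}=\rho_tP_{\pi_t}$, where $\pi_t$ is the policy played in episode $t$. There is a filtration $(\mathcal F_t)$ such that $\pi_t$ is $\mathcal F_t$-measurable and, given $\mathcal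 F_t$, the trajectory $(x_{t,n},a_{t,n})_{0\le n\le N}$ observed in episode $t$ is $\mathcal F_{t+1}$-measurable and has the law of a trajectory of the MDP with kernel $p$, policy $\pi_t$ and initial distribution $\rho_t$ (the observations are independent of the past). Let $N_{t,n}(x,a)$ be the number of $s<t$ with $(x_{s,n},a_{s,n})=(x,a)$; let $\hat p_{t,n+1}(\cdot|x,a)$ be the empirical frequencies of $x_{s,n+1}$ among these $s$, and the uniform distribution if $N_{t,n}(x,a)=0$. Put $\hat\mu_t^{\pi,\nu}=\mu^{\pi,\hat p_t,\nu}$, $\mu_t=\hat\mu_t^{\pi_t,\rho_t}$, and $$b_{t,n}=\frac{C_\delta}{\sqrt{\max\{1,N_{t,n}\}}},\qquad \bar b_{t,n}=\frac{\ell(N-n)C_\delta}{\sqrt{\max\{1,N_{t,n}\}}},\qquad C_\delta=\sqrt{2|\mathcal X|\log\frac{|\mathcal X||\mathcal A|NT}{\delta}} .$$ **Losses.** For $t\in[T]$, $n\in[N]$ the loss $f_{t,n}:\mathbb R^{\mathcal X\times\mathcal A}\to\mathbb R$ (possibly random) is convex and $\ell$-Lipschitz for $\|\cdot\|_1$, and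 $\ell_t=(\ell_{t,n})_{n\in[N]}$, where $\ell_{t,n}$ is a subgradient of $f_{t,n}$ at $\mu_{t,n}$ (the gradient, if it exists). **Algorithm.** Let $\mathcal M_t$ be the set of sequences $(\mu_n)_{0\le n\le N}$ of distributions on $\mathcal X\times\mathcal A$ with $\mu_0=\rho_t$ and $\sum_a\mu_{n}(x,a)=\sum_{x',a'}\mu_{n-1}(x',a')\,\hat p_{t,n}(x|x',a')$ for all $x$ and $n\in[N]$. The divergence $D_\psi(\mu,\mu')$ is either $\mathrm{KL}(\mu,\mu')=\sum_{n=0}^N\sum_{x,a}\mu_n\log\frac{\mu_n}{\mu_n'}$, with $\nabla\psi(\mu)_n(x,a)=1+\log\mu_n(x,a)$, or $\Gamma(\mu,\mu')=\sum_{n=1}^N\sum_{x,a}\mu_n(x,a)\log\frac{\pi_n(a|x)}{\pi'_n(a|x)}+\sum_{x,a}\mu_0\log\frac{\mu_0}{\mu_0'}$, where $\pi,\pi'$ are the policies of $\mu,\mu'$, with $\nabla\psi(\mu)_n(x,a)=\log\pi_n(a|x)$, for $n\in[N]$. The policy $\pi_1$ is arbitrary. For $1\le t<T$, provided that $\nabla\psi(\mu_t)$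 is defined and the constraint set below is non-empty, $$\mu_{t+1}\in\operatorname*{arg\,min}_{\mu\in\mathcal M_{t+1}}\ \eta\sum_{n=1}^N\langle\ell_{t,n}-\bar b_{t,n},\mu_n\rangle+D_\psi(\mu,\mu_t)\quad\text{s.t.}\quad\|\mu_N-\rho\|_1\le\sum_{n=0}^{N-1}\langle\mu_n,b_{t+1,n}\rangle+\alpha\|\rho_{t+1}-\rho\|_1 .$$ **Claim.** There are universal constants $C>0$ and $k\in\mathbb N$ such that, for all $\mathcal X,\mathcal A,N,T,\ell,\alpha,\Psi,\delta$ and either divergence, there is a step size $\eta>0$, depending only on these data, such that for all $p$, $\rho$, losses and runs as above there is an event of probability at least $1-3\delta$ on which the following holds. If, for all $t\in[T]$, $\nabla\psi(\mu_t)$ is defined (the arguments of its logarithms are positive) and $\|\nabla\psi(\mu_t)\|_{1,\infty}:=\sum_{n=1}^N\|\nabla\psi(\mu_t)_n\|_\infty\le\Psi$, then for every periodic policy $\pi$ $$\sum_{t=1}^T\sum_{n=1}^N\big\langle\ell_{t,n}-\bar b_{t,n},\,\mu_{t,n}-\hat\mu^{\pi,\rho_t}_{t,n}\big\rangle\ \le\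 C\,\ell N^3|\mathcal X|^{5/4}|\mathcal A|^{1/4}\sqrt{\frac{\Psi}{1-\alpha}}\;T^{3/4}\,\log^k\!\Big(\frac{|\mathcal X||\mathcal A|NT}{\delta}\Big).$$ -/

import Mathlib

open MeasureTheory ProbabilityTheory Finset

noncomputable section

/-!
Conventions.  `X`, `A` are the finite state and action spaces, `N` is the horizon.
The time steps inside an episode are `n = 0, …, N`, modelled by `Fin (N + 1)`.
For an index `i : Fin N`, the step `n - 1 = i` is `i.castSucc` and the step `n = i + 1` is `i.succ`;
`p i` is the transition kernel and `π i` the decision rule used on entering the step `i + 1`.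
The episodes `1, …, T` are numbered `0, …, T - 1`.
-/

namespace PeriodicMDP

variable {X A : Type*} [Fintype X] [Fintype A] {N : ℕ}

/-- The `L¹` norm of a vector indexed by a finite set. -/
def l1 {S : Type*} [Fintype S] (v : S → ℝ) : ℝ := ∑ y, |v y|

/-- `p i y x'` is the probability of moving to the state `x'` at step `i + 1`
from the state-action pair `y` at step `i`. -/
def IsKernel (p : Fin N → X × A → X → ℝ) : Prop := ∀ i y, p i y ∈ stdSimplex ℝ X

/-- `π i x a` is the probability of choosing `a` in the state `x` at step `i + 1`. -/
def IsPolicy (π : Fin N → X → A → ℝ) : Prop := ∀ i x, π i x ∈ stdSimplex ℝ A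

/-- The sequence of state-action distributions induced by the policy `π` in the MDP with kernel `p`
and initial state-action distribution `ν`. -/
def occ (p : Fin N → X × A → X → ℝ) (π : Fin N → X → A → ℝ) (ν : X × A → ℝ) :
    Fin (N + 1) → X × A → ℝ :=
  fun n => Fin.induction (motive := fun _ => X × A → ℝ) ν
    (fun i μ z => ∑ y, μ y * p i y z.1 * π i z.1 z.2) n

/-- `ν P_π`: the state-action distribution at the last step `N` when starting from `ν`. -/
def terminal (p : Fin N → X × A → X → ℝ) (π : Fin N → X → A → ℝ) (ν : X × A → ℝ) : X × A → ℝ :=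
  occ p π ν (Fin.last N)

/-- `π` is a periodic policy for the initial distribution `ρ`. -/
def IsPeriodic (p : Fin N → X × A → X → ℝ) (ρ : X × A → ℝ) (π : Fin N → X → A → ℝ) : Prop :=
  IsPolicy π ∧ terminal p π ρ = ρ

/-- Contraction assumption: every periodic policy contracts the `L¹` distance between initial
distributions by the factor `α`. -/
def Contracts (p : Fin N → X × A → X → ℝ) (ρ : X × A → ℝ) (α : ℝ) : Prop :=
  ∀ π, IsPeriodic p ρ π → ∀ ν ∈ stdSimplex ℝ (X × A), ∀ ν' ∈ stdSimplex ℝ (X × A),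
    l1 (terminal p π ν - terminal p π ν') ≤ α * l1 (ν - ν')

/-- Probability of the trajectory `τ` of an agent that starts from a pair drawn from `ν`
and follows the policy `π` in the MDP with kernel `p`. -/
def pathProb (p : Fin N → X × A → X → ℝ) (π : Fin N → X → A → ℝ) (ν : X × A → ℝ)
    (τ : Fin (N + 1) → X × A) : ℝ :=
  ν (τ 0) * ∏ i : Fin N, p i (τ i.castSucc) (τ i.succ).1 * π i (τ i.succ).1 (τ i.succ).2

/-- `M_ρ^p`: the sequences of state-action distributions starting at `ρ` and satisfying the
dynamics `p`. -/
def flowSet (p : Fin N → X × A → X → ℝ) (ρ : X × A → ℝ) : Set (Fin (N + 1) → X × A → ℝ) :=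
  {μ | (∀ n, μ n ∈ stdSimplex ℝ (X × A)) ∧ μ 0 = ρ ∧
    ∀ (i : Fin N) (x : X), ∑ a, μ i.succ (x, a) = ∑ y, μ i.castSucc y * p i y x}

/-- The initial distribution of each episode: there is no reset, so the initial distribution of an
episode is the final one of the previous episode. -/
def initDist (p : Fin N → X × A → X → ℝ) (ρ : X × A → ℝ) (pol : ℕ → Fin N → X → A → ℝ) :
    ℕ → X × A → ℝ
  | 0 => ρ
  | t + 1 => terminal p (pol t) (initDist p ρ pol t)

open Classical in
/-- Number of visits of the pair `y` at step `n` in the trajectories observed before episode `t`. -/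
def visits (h : ℕ → Fin (N + 1) → X × A) (t : ℕ) (n : Fin (N + 1)) (y : X × A) : ℕ :=
  #{s ∈ range t | h s n = y}

open Classical in
/-- Number of transitions from the pair `y` at step `i` to the state `x'` at step `i + 1` in the
trajectories observed before episode `t`. -/
def transitions (h : ℕ → Fin (N + 1) → X × A) (t : ℕ) (i : Fin N) (y : X × A) (x' : X) : ℕ :=
  #{s ∈ range t | h s i.castSucc = y ∧ (h s i.succ).1 = x'}

/-- The empirical kernel used in episode `t`; it keeps its initial value, the uniform distribution,
at the pairs that have not been visited yet. -/
def empKernel (h : ℕ → Fin (N + 1) → X × A) (t : ℕ) : Fin N → X × A → X → ℝ :=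
  fun i y x' =>
    if visits h t i.castSucc y = 0 then 1 / (Fintype.card X : ℝ)
    else (transitions h t i y x' : ℝ) / max 1 (visits h t i.castSucc y : ℝ)

variable (X A N) in
/-- The constant `C_δ` of the bonuses. -/
def bonusConst (T : ℕ) (δ : ℝ) : ℝ :=
  √(2 * (Fintype.card X : ℝ) *
    Real.log ((Fintype.card X : ℝ) * (Fintype.card A : ℝ) * (N : ℝ) * (T : ℝ) / δ))

/-- The bonus `b_t` of the constraint. -/
def bonus (T : ℕ) (δ : ℝ) (h : ℕ → Fin (N + 1) → X × A) (t : ℕ) : Fin (N + 1) → X × A → ℝ :=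
  fun n y => bonusConst X A N T δ / √(max 1 (visits h t n y : ℝ))

/-- The bonus `b̄_t` subtracted from the gradient of the loss. -/
def lossBonus (T : ℕ) (δ ℓ : ℝ) (h : ℕ → Fin (N + 1) → X × A) (t : ℕ) :
    Fin (N + 1) → X × A → ℝ :=
  fun n y => ℓ * ((N : ℝ) - (n : ℕ)) * bonusConst X A N T δ / √(max 1 (visits h t n y : ℝ))

/-- The vector `ℓ_t - b̄_t`, at the steps `1, …, N`; `g i` is the gradient of the loss of
step `i + 1`. -/
def mdVec (T : ℕ) (δ ℓ : ℝ) (h : ℕ → Fin (N + 1) → X × A) (g : Fin N → X × A → ℝ) (t : ℕ) :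
    Fin N → X × A → ℝ :=
  fun i y => g i y - lossBonus T δ ℓ h t i.succ y

/-- The pairing over the steps `1, …, N`. -/
def pairing (z : Fin N → X × A → ℝ) (μ : Fin (N + 1) → X × A → ℝ) : ℝ :=
  ∑ i : Fin N, ∑ y, z i y * μ i.succ y

/-- The constraint set of episode `t`: the flow set of the empirical kernel and of the current
initial distribution `ρt`, with the relaxed constraint on the final distribution.
The bonus is paired over the steps `0, …, N - 1`. -/
def constraintSet (T : ℕ) (δ α : ℝ) (ρ ρt : X × A → ℝ) (h : ℕ → Fin (N + 1) → X × A) (t : ℕ) :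
    Set (Fin (N + 1) → X × A → ℝ) :=
  {μ | μ ∈ flowSet (empKernel h t) ρt ∧
    l1 (μ (Fin.last N) - ρ) ≤
      ∑ i : Fin N, ∑ y, μ i.castSucc y * bonus T δ h t i.castSucc y + α * l1 (ρt - ρ)}

/-- The two mirror-descent divergences. -/
inductive Div
  | kl
  | gamma

/-- The divergence `D_ψ(μ, μ')`, where `μ'` is the sequence induced by the policy `π'`.
For `kl` it is induced by `ψ(μ) = ∑ μ_n(x,a) log μ_n(x,a)`, over all steps; for `gamma` it is induced
by `ψ(μ) = ∑_{n ≥ 1} μ_n(x,a) log (μ_n(x,a) / ∑_b μ_n(x,b)) + ∑ μ_0(x,a) log μ_0(x,a)`.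
The terms of the step `0` are constant on the constraint sets, where `μ_0` is prescribed. -/
def Div.val : Div → (μ μ' : Fin (N + 1) → X × A → ℝ) → (π' : Fin N → X → A → ℝ) → ℝ
  | .kl, μ, μ', _ => ∑ n, ∑ y, μ n y * Real.log (μ n y / μ' n y)
  | .gamma, μ, μ', π' =>
      ∑ i : Fin N, ∑ x, ∑ a, μ i.succ (x, a) *
          Real.log ((μ i.succ (x, a) / ∑ b, μ i.succ (x, b)) / π' i x a)
        + ∑ y, μ 0 y * Real.log (μ 0 y / μ' 0 y)

/-- `ψ` is differentiable at the sequence `μ` induced by the policy `π`, in the variables of the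
steps `1, …, N`. -/
def Div.Regular : Div → (μ : Fin (N + 1) → X × A → ℝ) → (π : Fin N → X → A → ℝ) → Prop
  | .kl, μ, _ => ∀ (i : Fin N) (y : X × A), 0 < μ i.succ y
  | .gamma, _, π => ∀ (i : Fin N) (x : X) (a : A), 0 < π i x a

/-- The gradient of `ψ` at the sequence `μ` induced by the policy `π`, at the steps `1, …, N`. -/
def Div.grad : Div → (μ : Fin (N + 1) → X × A → ℝ) → (π : Fin N → X → A → ℝ) → Fin N → X × A → ℝ
  | .kl, μ, _ => fun i y => Real.log (μ i.succ y) + 1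
  | .gamma, _, π => fun i y => Real.log (π i y.1 y.2)

/-- The norm `‖v‖_{1,∞} = ∑_n ‖v_n‖_∞`. -/
def norm1inf (v : Fin N → X × A → ℝ) : ℝ := ∑ i, ⨆ y, |v i y|

/-- `μ_t`: the state-action distributions induced in the estimated MDP by the policy played in
episode `t`, from the initial distribution of the episode. -/
def iterate (p : Fin N → X × A → X → ℝ) (ρ : X × A → ℝ) (h : ℕ → Fin (N + 1) → X × A)
    (pol : ℕ → Fin N → X → A → ℝ) (t : ℕ) : Fin (N + 1) → X × A → ℝ :=
  occ (empKernel h t) (pol t) (initDist p ρ pol t)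

/-- `g` is a subgradient of `f` at `u` (the gradient, if `f` is convex and differentiable at `u`). -/
def IsSubgradient (f : (X × A → ℝ) → ℝ) (u g : X × A → ℝ) : Prop :=
  ∀ v, f u + ∑ y, g y * (v y - u y) ≤ f v

/-- The losses of all episodes and steps are convex and `ℓ`-Lipschitz for the `L¹` norm. -/
def IsLoss (ℓ : ℝ) (T : ℕ) (f : ℕ → Fin N → (X × A → ℝ) → ℝ) : Prop :=
  ∀ t < T, ∀ i, ConvexOn ℝ Set.univ (f t i) ∧ ∀ u v, |f t i u - f t i v| ≤ ℓ * l1 (u - v)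

/-- The mirror-descent rule along one realization: in each episode, the next iterate solves the
constrained problem, whenever the divergence to the current iterate is defined and the constraint
set is non-empty. -/
def FollowsRule (D : Div) (T : ℕ) (δ ℓ α η : ℝ) (p : Fin N → X × A → X → ℝ) (ρ : X × A → ℝ)
    (h : ℕ → Fin (N + 1) → X × A) (pol : ℕ → Fin N → X → A → ℝ)
    (g : ℕ → Fin N → X × A → ℝ) : Prop :=
  ∀ t, t + 1 < T → D.Regular (iterate p ρ h pol t) (pol t) →
    (constraintSet T δ α ρ (initDist p ρ pol (t + 1)) h (t + 1)).Nonempty →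
    iterate p ρ h pol (t + 1) ∈ constraintSet T δ α ρ (initDist p ρ pol (t + 1)) h (t + 1) ∧
    IsMinOn (fun μ => η * pairing (mdVec T δ ℓ h (g t) t) μ + D.val μ (iterate p ρ h pol t) (pol t))
      (constraintSet T δ α ρ (initDist p ρ pol (t + 1)) h (t + 1)) (iterate p ρ h pol (t + 1))

/-- The mirror-descent regret term `∑_t ⟨ℓ_t - b̄_t, μ_t - μ̂_t^{π, ρ_t}⟩` against the policy `π`. -/
def regretMD (T : ℕ) (δ ℓ : ℝ) (p : Fin N → X × A → X → ℝ) (ρ : X × A → ℝ)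
    (h : ℕ → Fin (N + 1) → X × A) (pol : ℕ → Fin N → X → A → ℝ)
    (g : ℕ → Fin N → X × A → ℝ) (π : Fin N → X → A → ℝ) : ℝ :=
  ∑ t ∈ range T, pairing (mdVec T δ ℓ h (g t) t)
    (iterate p ρ h pol t - occ (empKernel h t) π (initDist p ρ pol t))

/-- The observation model.  `ℱ t` is the information available before episode `t`; the policy of
episode `t` is `ℱ t`-measurable, and, given `ℱ t`, the trajectory observed in episode `t` is that of
an agent that starts from a pair drawn from the current initial distribution and plays the
current policy in the true MDP. -/
structure IsObservation {Ω : Type*} [mΩ : MeasurableSpace Ω] (P : Measure Ω) (ℱ : Filtration ℕ mΩ)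
    (T : ℕ) (p : Fin N → X × A → X → ℝ) (ρ : X × A → ℝ)
    (traj : ℕ → Ω → Fin (N + 1) → X × A) (pol : ℕ → Ω → Fin N → X → A → ℝ) : Prop where
  isPolicy : ∀ t < T, ∀ ω, IsPolicy (pol t ω)
  measurable_pol : ∀ t < T, Measurable[ℱ t] (pol t)
  measurable_traj : ∀ t < T, ∀ τ, MeasurableSet[ℱ (t + 1)] {ω | traj t ω = τ}
  condLaw : ∀ t < T, ∀ τ,
    P[Set.indicator {ω | traj t ω = τ} (fun _ => (1 : ℝ)) | ℱ t] =ᵐ[P]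
      fun ω => pathProb p (pol t ω) (initDist p ρ (fun s => pol s ω) t) τ

end PeriodicMDP

end

/-!
The rule is mirror descent in a model and on a constraint set that change with the episode. On the
good event every periodic policy stays feasible: the bonus in the constraint is exactly what it
costs to replace `p` by its estimate. First-order optimality on the constraint set and a
Pinsker-type inequality then bound each one-step regret by a difference of divergences, up to a term
of order `η ‖ℓ_t - b̄_t‖²`.

These differences would telescope for a fixed comparison point. Here it moves with the initial
distribution and with the empirical kernels, and each move costs `Ψ / η` times its `L¹` length. An
empirical kernel moves only at the visited pair, by at most `2 / √N_t`, and the distance from the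
initial distribution to `ρ` is contracted by `α` in each episode up to the expected bonuses. Hence
the total drift is of order `√T / (1 - α)`; as the other term is of order `T η`, the best `η` is of
order `T ^ (-1/4)`, and the regret of order `T ^ (3/4)`.
-/

namespace PeriodicMDP

section FiniteVectors

variable {S : Type*} [Fintype S]

lemma l1_nonneg (v : S → ℝ) : 0 ≤ l1 v :=
  sum_nonneg fun _ _ => abs_nonneg _

lemma l1_add_le (u v : S → ℝ) : l1 (u + v) ≤ l1 u + l1 v := by
  simp only [l1, ← sum_add_distrib]
  exact sum_le_sum fun y _ => abs_add_le _ _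

lemma l1_smul (c : ℝ) (v : S → ℝ) : l1 (c • v) = |c| * l1 v := by
  simp only [l1, Pi.smul_apply, smul_eq_mul, abs_mul, mul_sum]

lemma l1_sub_comm (u v : S → ℝ) : l1 (u - v) = l1 (v - u) := by
  simp only [l1, Pi.sub_apply, abs_sub_comm]

lemma l1_sub_le (u v w : S → ℝ) : l1 (u - w) ≤ l1 (u - v) + l1 (v - w) := by
  simpa only [sub_add_sub_cancel] using l1_add_le (u - v) (v - w)

lemma l1_of_mem_stdSimplex {u : S → ℝ} (hu : u ∈ stdSimplex ℝ S) : l1 u = 1 := by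
  rw [← hu.2]
  exact sum_congr rfl fun y _ => abs_of_nonneg (hu.1 y)

lemma l1_sub_le_two {u v : S → ℝ} (hu : u ∈ stdSimplex ℝ S) (hv : v ∈ stdSimplex ℝ S) :
    l1 (u - v) ≤ 2 := by
  have h := l1_sub_le u 0 v
  rw [l1_sub_comm 0 v, sub_zero, sub_zero, l1_of_mem_stdSimplex hu, l1_of_mem_stdSimplex hv] at h
  linarith

lemma l1_sub_self (u : S → ℝ) : l1 (u - u) = 0 := by
  simp [l1]

lemma eq_of_mem_stdSimplex_of_subsingleton [Subsingleton S] {u v : S → ℝ}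
    (hu : u ∈ stdSimplex ℝ S) (hv : v ∈ stdSimplex ℝ S) : u = v := by
  ext y
  rw [← Fintype.sum_subsingleton u y, ← Fintype.sum_subsingleton v y, hu.2, hv.2]

lemma abs_sum_mul_le {z : S → ℝ} {c : ℝ} (hz : ∀ y, |z y| ≤ c) (u : S → ℝ) :
    |∑ y, z y * u y| ≤ c * l1 u := by
  rw [l1, mul_sum]
  refine (abs_sum_le_sum_abs _ _).trans (sum_le_sum fun y _ => ?_)
  rw [abs_mul]
  exact mul_le_mul_of_nonneg_right (hz y) (abs_nonneg _)

lemma le_add_sum_of_succ_le {N : ℕ} {a : Fin (N + 1) → ℝ} {c : Fin N → ℝ} (hc : ∀ i, 0 ≤ c i)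
    (h : ∀ i : Fin N, a i.succ ≤ a i.castSucc + c i) (n : Fin (N + 1)) : a n ≤ a 0 + ∑ i, c i := by
  induction N with
  | zero => simp [Fin.fin_one_eq_zero n]
  | succ N ih =>
    rw [Fin.sum_univ_succ, ← add_assoc]
    refine Fin.cases ?_ (fun j => ?_) n
    · linarith [hc 0, sum_nonneg fun i (_ : i ∈ univ) => hc (Fin.succ i)]
    · have htail := ih (a := fun i => a i.succ) (fun i => hc i.succ) (fun i => h i.succ) j
      exact htail.trans (add_le_add_left (h 0) _)

end FiniteVectors

section OneStep

variable {S X A : Type*} [Fintype S]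

/-- The law of the next state when the current point is drawn from `ν` and the transition
probabilities are given by `k`. -/
def push (ν : S → ℝ) (k : S → X → ℝ) : X → ℝ := fun x => ∑ y, ν y * k y x

/-- The joint law of a state drawn from `m` and of an action drawn from the decision rule `σ`. -/
def joint (m : X → ℝ) (σ : X → A → ℝ) : X × A → ℝ := fun z => m z.1 * σ z.1 z.2

lemma push_nonneg {ν : S → ℝ} {k : S → X → ℝ} (hν : ∀ y, 0 ≤ ν y) (hk : ∀ y x, 0 ≤ k y x) (x : X) :
    0 ≤ push ν k x :=
  sum_nonneg fun y _ => mul_nonneg (hν y) (hk y x)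

lemma sum_joint [Fintype A] (m : X → ℝ) {σ : X → A → ℝ} {x : X} (hσ : σ x ∈ stdSimplex ℝ A) :
    ∑ a, joint m σ (x, a) = m x := by
  simp only [joint, ← mul_sum, hσ.2, mul_one]

variable [Fintype X]

lemma sum_push (ν : S → ℝ) {k : S → X → ℝ} (hk : ∀ y, k y ∈ stdSimplex ℝ X) :
    ∑ x, push ν k x = ∑ y, ν y := by
  simp only [push]
  rw [sum_comm]
  simp only [← mul_sum, (hk _).2, mul_one]

lemma push_mem_stdSimplex {ν : S → ℝ} {k : S → X → ℝ} (hν : ν ∈ stdSimplex ℝ S)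
    (hk : ∀ y, k y ∈ stdSimplex ℝ X) : push ν k ∈ stdSimplex ℝ X :=
  ⟨push_nonneg hν.1 fun y => (hk y).1, (sum_push ν hk).trans hν.2⟩

lemma l1_push_sub_le {ν ν' : S → ℝ} {k k' : S → X → ℝ} (hν : ∀ y, 0 ≤ ν y)
    (hk' : ∀ y, k' y ∈ stdSimplex ℝ X) :
    l1 (push ν k - push ν' k') ≤ l1 (ν - ν') + ∑ y, ν y * l1 (k y - k' y) := by
  have hpointwise (x : X) : |push ν k x - push ν' k' x| ≤
      push (fun y => |ν y - ν' y|) k' x + ∑ y, ν y * |k y x - k' y x| := by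
    simp only [push]
    rw [← sum_sub_distrib, ← sum_add_distrib]
    refine (abs_sum_le_sum_abs _ _).trans (sum_le_sum fun y _ => ?_)
    calc |ν y * k y x - ν' y * k' y x|
        = |(ν y - ν' y) * k' y x + ν y * (k y x - k' y x)| := by congr 1; ring
      _ ≤ |ν y - ν' y| * k' y x + ν y * |k y x - k' y x| := by
        refine (abs_add_le _ _).trans_eq ?_
        rw [abs_mul, abs_mul, abs_of_nonneg (hν y), abs_of_nonneg ((hk' y).1 x)]
  refine (sum_le_sum fun x _ => hpointwise x).trans_eq ?_
  rw [sum_add_distrib, sum_push _ hk', sum_comm]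
  simp only [← mul_sum]
  rfl

variable [Fintype A]

lemma joint_mem_stdSimplex {m : X → ℝ} {σ : X → A → ℝ} (hm : m ∈ stdSimplex ℝ X)
    (hσ : ∀ x, σ x ∈ stdSimplex ℝ A) : joint m σ ∈ stdSimplex ℝ (X × A) := by
  refine ⟨fun z => mul_nonneg (hm.1 _) ((hσ _).1 _), ?_⟩
  simp only [Fintype.sum_prod_type, sum_joint m (hσ _), hm.2]

lemma l1_joint_sub (m m' : X → ℝ) {σ : X → A → ℝ} (hσ : ∀ x, σ x ∈ stdSimplex ℝ A) :
    l1 (joint m σ - joint m' σ) = l1 (m - m') := by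
  simp only [l1, Fintype.sum_prod_type, Pi.sub_apply, joint, ← sub_mul, abs_mul,
    abs_of_nonneg ((hσ _).1 _), ← mul_sum, (hσ _).2, mul_one]

end OneStep

section Occupation

variable {X A : Type*} [Fintype X] [Fintype A] {N : ℕ} {p p' : Fin N → X × A → X → ℝ}
  {π : Fin N → X → A → ℝ} {ν : X × A → ℝ}

lemma occ_succ (p : Fin N → X × A → X → ℝ) (π : Fin N → X → A → ℝ) (ν : X × A → ℝ) (i : Fin N) :
    occ p π ν i.succ = joint (push (occ p π ν i.castSucc) (p i)) (π i) := by
  ext z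
  simp only [joint, push, sum_mul]
  rfl

lemma sum_occ_succ (hπ : IsPolicy π) (i : Fin N) (x : X) :
    ∑ a, occ p π ν i.succ (x, a) = push (occ p π ν i.castSucc) (p i) x := by
  rw [occ_succ, sum_joint _ (hπ i x)]

lemma occ_mem_stdSimplex (hp : IsKernel p) (hπ : IsPolicy π) (hν : ν ∈ stdSimplex ℝ (X × A))
    (n : Fin (N + 1)) : occ p π ν n ∈ stdSimplex ℝ (X × A) := by
  induction n using Fin.induction with
  | zero => exact hν
  | succ i ih =>
    rw [occ_succ]
    exact joint_mem_stdSimplex (push_mem_stdSimplex ih (hp i)) (hπ i)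

lemma occ_mem_flowSet (hp : IsKernel p) (hπ : IsPolicy π) (hν : ν ∈ stdSimplex ℝ (X × A)) :
    occ p π ν ∈ flowSet p ν :=
  ⟨occ_mem_stdSimplex hp hπ hν, rfl, fun i x => sum_occ_succ hπ i x⟩

lemma initDist_mem_stdSimplex {ρ : X × A → ℝ} {pol : ℕ → Fin N → X → A → ℝ} {T : ℕ}
    (hp : IsKernel p) (hρ : ρ ∈ stdSimplex ℝ (X × A)) (hpol : ∀ t < T, IsPolicy (pol t))
    {t : ℕ} (ht : t ≤ T) : initDist p ρ pol t ∈ stdSimplex ℝ (X × A) := by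
  induction t with
  | zero => exact hρ
  | succ t ih => exact occ_mem_stdSimplex hp (hpol t ht) (ih (by lia)) (Fin.last N)

lemma l1_occ_sub_le {ν' : X × A → ℝ} (hp : IsKernel p) (hp' : IsKernel p') (hπ : IsPolicy π)
    (hν : ν ∈ stdSimplex ℝ (X × A)) (n : Fin (N + 1)) :
    l1 (occ p π ν n - occ p' π ν' n) ≤
      l1 (ν - ν') + ∑ i : Fin N, ∑ y, occ p π ν i.castSucc y * l1 (p i y - p' i y) := by
  have hocc (i : Fin N) := (occ_mem_stdSimplex hp hπ hν i.castSucc).1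
  refine le_add_sum_of_succ_le (a := fun n => l1 (occ p π ν n - occ p' π ν' n))
    (fun i => sum_nonneg fun y _ => mul_nonneg (hocc i y) (l1_nonneg _)) (fun i => ?_) n
  rw [occ_succ, occ_succ, l1_joint_sub _ _ (hπ i)]
  exact l1_push_sub_le (hocc i) (hp' i)

end Occupation

section Counts

variable {X A : Type*} {N : ℕ} (h : ℕ → Fin (N + 1) → X × A) (t : ℕ)

/-- The inverse square root of the number of visits, the common shape of the two bonuses. -/
noncomputable def invSqrtVisits (n : Fin (N + 1)) (y : X × A) : ℝ :=
  1 / √(max 1 (visits h t n y : ℝ))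

lemma invSqrtVisits_nonneg (n : Fin (N + 1)) (y : X × A) : 0 ≤ invSqrtVisits h t n y := by
  unfold invSqrtVisits
  positivity

lemma invSqrtVisits_le_one (n : Fin (N + 1)) (y : X × A) : invSqrtVisits h t n y ≤ 1 :=
  (div_le_one (by positivity)).2 (Real.one_le_sqrt.2 (le_max_left _ _))

lemma visits_succ (n : Fin (N + 1)) (y : X × A) [Decidable (h t n = y)] :
    visits h (t + 1) n y = visits h t n y + if h t n = y then 1 else 0 := by
  classical
  simp only [visits, range_add_one, filter_insert]
  split_ifs <;> simp_all

lemma transitions_succ (i : Fin N) (y : X × A) (x : X)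
    [Decidable (h t i.castSucc = y ∧ (h t i.succ).1 = x)] :
    transitions h (t + 1) i y x =
      transitions h t i y x + if h t i.castSucc = y ∧ (h t i.succ).1 = x then 1 else 0 := by
  classical
  simp only [transitions, range_add_one, filter_insert]
  split_ifs <;> simp_all

lemma sum_transitions [Fintype X] (i : Fin N) (y : X × A) :
    ∑ x, transitions h t i y x = visits h t i.castSucc y := by
  classical
  induction t with
  | zero => simp [transitions, visits]
  | succ t ih =>
    simp only [visits_succ, transitions_succ, sum_add_distrib, ih]
    by_cases hy : h t i.castSucc = y <;> simp [hy]

lemma visits_le (n : Fin (N + 1)) (y : X × A) : visits h t n y ≤ t := by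
  classical exact (card_filter_le _ _).trans_eq (card_range t)

lemma one_div_sqrt_max_one_le (k : ℕ) : 1 / √(max 1 (k : ℝ)) ≤ 3 * (√(k + 1 : ℝ) - √k) := by
  rcases Nat.eq_zero_or_pos k with rfl | hk
  · norm_num
  have hk : (1 : ℝ) ≤ k := by exact_mod_cast hk
  have hle : √k ≤ √(k + 1 : ℝ) := Real.sqrt_le_sqrt (by linarith)
  have htwice : √(k + 1 : ℝ) ≤ 2 * √k := by
    rw [Real.sqrt_le_left (by positivity), mul_pow, Real.sq_sqrt (by positivity)]
    linarith
  have hone : (√(k + 1 : ℝ) - √k) * (√(k + 1 : ℝ) + √k) = 1 := by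
    rw [mul_comm, ← sq_sub_sq, Real.sq_sqrt (by positivity), Real.sq_sqrt (by positivity)]
    ring
  rw [max_eq_right hk, div_le_iff₀ (Real.sqrt_pos.2 (by linarith))]
  linarith [mul_le_mul_of_nonneg_left htwice (sub_nonneg.2 hle)]

variable [Fintype X] [Fintype A]

lemma sum_visits (n : Fin (N + 1)) : ∑ y, visits h t n y = t := by
  classical
  induction t with
  | zero => simp [visits]
  | succ t ih => simp [visits_succ, sum_add_distrib, ih]

lemma sum_sqrt_visits_succ (n : Fin (N + 1)) :
    ∑ y, √(visits h (t + 1) n y : ℝ) = ∑ y, √(visits h t n y : ℝ) +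
      (√(visits h t n (h t n) + 1 : ℝ) - √(visits h t n (h t n) : ℝ)) := by
  classical
  rw [← sub_eq_iff_eq_add', ← sum_sub_distrib, sum_eq_single (h t n)]
  · simp [visits_succ]
  · intro y _ hy
    simp [visits_succ, Ne.symm hy]
  · simp

lemma sum_sqrt_visits_le (n : Fin (N + 1)) :
    ∑ y, √(visits h t n y : ℝ) ≤ √((Fintype.card X : ℝ) * Fintype.card A * t) := by
  refine Real.le_sqrt_of_sq_le (sq_sum_le_card_mul_sum_sq.trans_eq ?_)
  simp only [Real.sq_sqrt (Nat.cast_nonneg _), card_univ, Fintype.card_prod]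
  rw [← Nat.cast_sum, sum_visits, Nat.cast_mul]

lemma sum_invSqrtVisits_le (n : Fin (N + 1)) :
    ∑ s ∈ range t, invSqrtVisits h s n (h s n) ≤
      3 * √((Fintype.card X : ℝ) * Fintype.card A * t) := by
  suffices hpotential :
      ∑ s ∈ range t, invSqrtVisits h s n (h s n) ≤ 3 * ∑ y, √(visits h t n y : ℝ) from
    hpotential.trans (mul_le_mul_of_nonneg_left (sum_sqrt_visits_le h t n) (by norm_num))
  induction t with
  | zero => simp [visits]
  | succ t ih =>
    rw [sum_range_succ, sum_sqrt_visits_succ, mul_add]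
    exact add_le_add ih (one_div_sqrt_max_one_le _)

end Counts

section EmpiricalKernel

variable {X A : Type*} [Fintype X] {N : ℕ} {h : ℕ → Fin (N + 1) → X × A} {t : ℕ} {i : Fin N}
  {y : X × A}

lemma empKernel_of_visits_ne_zero (hv : visits h t i.castSucc y ≠ 0) (x : X) :
    empKernel h t i y x = (transitions h t i y x : ℝ) / visits h t i.castSucc y := by
  have : (1 : ℝ) ≤ visits h t i.castSucc y := by exact_mod_cast Nat.one_le_iff_ne_zero.2 hv
  simp [empKernel, hv, max_eq_right this]

lemma isKernel_empKernel [Nonempty X] (h : ℕ → Fin (N + 1) → X × A) (t : ℕ) :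
    IsKernel (empKernel h t) := by
  intro i y
  by_cases hv : visits h t i.castSucc y = 0
  · have huniform : empKernel h t i y = fun _ => 1 / (Fintype.card X : ℝ) := by
      ext x
      simp [empKernel, hv]
    rw [huniform]
    exact ⟨fun _ => by positivity, by simp⟩
  · constructor
    · intro x
      rw [empKernel_of_visits_ne_zero hv]
      positivity
    · simp only [empKernel_of_visits_ne_zero hv, ← sum_div]
      rw [← Nat.cast_sum, sum_transitions, div_self]
      exact_mod_cast hv

lemma empKernel_succ_of_ne (hy : h t i.castSucc ≠ y) :
    empKernel h (t + 1) i y = empKernel h t i y := by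
  classical
  ext x
  simp [empKernel, visits_succ, transitions_succ, hy]

lemma empKernel_succ_sub [DecidableEq X] (hv : visits h t i.castSucc (h t i.castSucc) ≠ 0) :
    empKernel h (t + 1) i (h t i.castSucc) - empKernel h t i (h t i.castSucc) =
      (1 / ((visits h t i.castSucc (h t i.castSucc) : ℝ) + 1)) •
        (Pi.single (h t i.succ).1 1 - empKernel h t i (h t i.castSucc)) := by
  classical
  ext x
  have hcount : visits h (t + 1) i.castSucc (h t i.castSucc) =
      visits h t i.castSucc (h t i.castSucc) + 1 := by simp [visits_succ]
  have hv' : (visits h t i.castSucc (h t i.castSucc) : ℝ) ≠ 0 := by exact_mod_cast hv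
  simp only [Pi.sub_apply, Pi.smul_apply, smul_eq_mul, Pi.single_apply]
  rw [empKernel_of_visits_ne_zero (by lia), empKernel_of_visits_ne_zero hv, hcount,
    transitions_succ]
  simp only [true_and, eq_comm (a := x)]
  push_cast
  field_simp
  ring

lemma l1_empKernel_succ_sub_le [Nonempty X] (h : ℕ → Fin (N + 1) → X × A) (t : ℕ) (i : Fin N)
    (y : X × A) :
    l1 (empKernel h (t + 1) i y - empKernel h t i y) ≤
      2 * invSqrtVisits h t i.castSucc (h t i.castSucc) := by
  classical
  rcases ne_or_eq (h t i.castSucc) y with hy | rfl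
  · rw [empKernel_succ_of_ne hy, sub_self]
    simpa [l1] using invSqrtVisits_nonneg h t i.castSucc (h t i.castSucc)
  have hemp := isKernel_empKernel h t i (h t i.castSucc)
  by_cases hv : visits h t i.castSucc (h t i.castSucc) = 0
  · simpa [invSqrtVisits, hv] using
      l1_sub_le_two (isKernel_empKernel h (t + 1) i (h t i.castSucc)) hemp
  · rw [empKernel_succ_sub hv, l1_smul, abs_of_nonneg (by positivity), mul_comm, invSqrtVisits]
    have hv1 : (1 : ℝ) ≤ visits h t i.castSucc (h t i.castSucc) := by
      exact_mod_cast Nat.one_le_iff_ne_zero.2 hv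
    rw [max_eq_right hv1]
    gcongr
    · exact l1_sub_le_two (single_mem_stdSimplex ℝ _) hemp
    · exact (Real.sqrt_le_left (by linarith)).2 (by nlinarith)

end EmpiricalKernel

section Pairing

variable {X A : Type*} {N : ℕ}

lemma norm1inf_nonneg (v : Fin N → X × A → ℝ) : 0 ≤ norm1inf v :=
  sum_nonneg fun _ _ => Real.iSup_nonneg fun _ => abs_nonneg _

lemma norm1inf_le {v : Fin N → X × A → ℝ} {c : ℝ} (hc : 0 ≤ c) (hv : ∀ i y, |v i y| ≤ c) :
    norm1inf v ≤ N * c :=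
  (sum_le_card_nsmul _ _ c fun i _ => Real.iSup_le (hv i) hc).trans_eq (by simp)

lemma abs_le_iSup_abs [Finite X] [Finite A] (u : X × A → ℝ) (y : X × A) : |u y| ≤ ⨆ z, |u z| :=
  le_ciSup (f := fun z => |u z|) (Set.finite_range _).bddAbove y

lemma abs_le_norm1inf [Finite X] [Finite A] (v : Fin N → X × A → ℝ) (i : Fin N) (y : X × A) :
    |v i y| ≤ norm1inf v :=
  (abs_le_iSup_abs (v i) y).trans <| single_le_sum (f := fun j => ⨆ z, |v j z|)
    (fun _ _ => Real.iSup_nonneg fun _ => abs_nonneg _) (mem_univ i)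

variable [Fintype X] [Fintype A]

lemma pairing_sub (z : Fin N → X × A → ℝ) (μ μ' : Fin (N + 1) → X × A → ℝ) :
    pairing z (μ - μ') = pairing z μ - pairing z μ' := by
  simp [pairing, mul_sub, sum_sub_distrib]

lemma pairing_sub_left (z z' : Fin N → X × A → ℝ) (μ : Fin (N + 1) → X × A → ℝ) :
    pairing (z - z') μ = pairing z μ - pairing z' μ := by
  simp [pairing, sub_mul, sum_sub_distrib]

lemma abs_pairing_le (z : Fin N → X × A → ℝ) {μ : Fin (N + 1) → X × A → ℝ} {d : ℝ}
    (hμ : ∀ i : Fin N, l1 (μ i.succ) ≤ d) : |pairing z μ| ≤ norm1inf z * d := by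
  rw [norm1inf, sum_mul]
  refine (abs_sum_le_sum_abs _ _).trans (sum_le_sum fun i _ => ?_)
  refine (abs_sum_mul_le (abs_le_iSup_abs (z i)) _).trans ?_
  exact mul_le_mul_of_nonneg_left (hμ i) (Real.iSup_nonneg fun _ => abs_nonneg _)

end Pairing

section RelativeEntropy

variable {S : Type*} [Fintype S] {a b : S → ℝ}

/-- The relative entropy of `a` with respect to `b`, to be used for non-negative vectors such that
`a` vanishes wherever `b` does. -/
noncomputable def relEnt (a b : S → ℝ) : ℝ := ∑ y, a y * (Real.log (a y) - Real.log (b y))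

lemma sub_le_mul_log_sub_log {u v : ℝ} (hu : 0 ≤ u) (hv : 0 ≤ v) (huv : v = 0 → u = 0) :
    u - v ≤ u * (Real.log u - Real.log v) := by
  rcases hu.eq_or_lt with rfl | hu
  · simpa using hv
  have hv : 0 < v := hv.lt_of_ne fun h => hu.ne' (huv h.symm)
  have hlog := Real.log_le_sub_one_of_pos (div_pos hv hu)
  rw [Real.log_div hv.ne' hu.ne', le_sub_iff_add_le, le_div_iff₀ hu] at hlog
  linarith

lemma log_sum_le (ha : ∀ y, 0 ≤ a y) (hb : ∀ y, 0 ≤ b y) (hab : ∀ y, b y = 0 → a y = 0) :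
    (∑ y, a y) * (Real.log (∑ y, a y) - Real.log (∑ y, b y)) ≤ relEnt a b := by
  set U := ∑ y, a y
  set V := ∑ y, b y
  rcases (sum_nonneg fun y (_ : y ∈ univ) => ha y).eq_or_lt with hU | hU
  · have hzero (y : S) : a y = 0 :=
      (sum_eq_zero_iff_of_nonneg fun y _ => ha y).1 hU.symm y (mem_univ y)
    simp [U, relEnt, hzero]
  obtain ⟨y₀, -, hy₀⟩ := exists_ne_zero_of_sum_ne_zero hU.ne'
  have hV : 0 < V :=
    sum_pos' (fun y _ => hb y) ⟨y₀, mem_univ _, (hb y₀).lt_of_ne fun h => hy₀ (hab y₀ h.symm)⟩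
  have hterm (y : S) : a y - b y * (U / V) ≤
      a y * (Real.log (a y) - Real.log (b y)) - a y * (Real.log U - Real.log V) := by
    by_cases hby : b y = 0
    · simp [hby, hab y hby]
    have htangent := sub_le_mul_log_sub_log (ha y) (mul_nonneg (hb y) (div_pos hU hV).le)
      fun h => absurd h (mul_ne_zero hby (div_pos hU hV).ne')
    rw [Real.log_mul hby (div_pos hU hV).ne', Real.log_div hU.ne' hV.ne'] at htangent
    linarith
  have hsum := sum_le_sum fun y (_ : y ∈ univ) => hterm y
  rw [sum_sub_distrib, sum_sub_distrib, ← sum_mul, ← sum_mul, mul_div_cancel₀ _ hV.ne'] at hsum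
  change U - U ≤ relEnt a b - U * (Real.log U - Real.log V) at hsum
  linarith

lemma relEnt_nonneg (ha : a ∈ stdSimplex ℝ S) (hb : b ∈ stdSimplex ℝ S)
    (hab : ∀ y, b y = 0 → a y = 0) : 0 ≤ relEnt a b := by
  simpa [ha.2, hb.2] using log_sum_le ha.1 hb.1 hab

lemma sum_sq_sqrt_sub_sqrt_le_relEnt (ha : a ∈ stdSimplex ℝ S) (hb : b ∈ stdSimplex ℝ S)
    (hab : ∀ y, b y = 0 → a y = 0) : ∑ y, (√(a y) - √(b y)) ^ 2 ≤ relEnt a b := by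
  have hterm (y : S) : (√(a y) - √(b y)) ^ 2 ≤
      a y * (Real.log (a y) - Real.log (b y)) + (b y - a y) := by
    have htangent := sub_le_mul_log_sub_log (Real.sqrt_nonneg (a y)) (Real.sqrt_nonneg (b y))
      fun h => by rw [hab y ((Real.sqrt_eq_zero (hb.1 y)).1 h), Real.sqrt_zero]
    have hscaled := mul_le_mul_of_nonneg_left htangent (Real.sqrt_nonneg (a y))
    rw [Real.log_sqrt (ha.1 y), Real.log_sqrt (hb.1 y), ← mul_assoc,
      Real.mul_self_sqrt (ha.1 y)] at hscaled
    linarith [Real.sq_sqrt (ha.1 y), Real.sq_sqrt (hb.1 y)]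
  refine (sum_le_sum fun y _ => hterm y).trans_eq ?_
  rw [sum_add_distrib, sum_sub_distrib, ha.2, hb.2, sub_self, add_zero, relEnt]

lemma sq_l1_sub_le_sum_sq_sqrt_sub_sqrt (ha : a ∈ stdSimplex ℝ S) (hb : b ∈ stdSimplex ℝ S) :
    l1 (a - b) ^ 2 ≤ 4 * ∑ y, (√(a y) - √(b y)) ^ 2 := by
  have hfactor (y : S) : |a y - b y| = |√(a y) - √(b y)| * (√(a y) + √(b y)) := by
    have hsum : 0 ≤ √(a y) + √(b y) := by positivity
    rw [← abs_of_nonneg hsum, ← abs_mul, mul_comm, ← sq_sub_sq, Real.sq_sqrt (ha.1 y),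
      Real.sq_sqrt (hb.1 y)]
  have hfour : ∑ y, (√(a y) + √(b y)) ^ 2 ≤ 4 := by
    refine (sum_le_sum fun y _ => add_sq_le).trans_eq ?_
    simp only [Real.sq_sqrt (ha.1 _), Real.sq_sqrt (hb.1 _), ← mul_sum, sum_add_distrib, ha.2, hb.2]
    norm_num
  calc l1 (a - b) ^ 2 = (∑ y, |√(a y) - √(b y)| * (√(a y) + √(b y))) ^ 2 := by
        simp only [l1, Pi.sub_apply, hfactor]
    _ ≤ (∑ y, (√(a y) - √(b y)) ^ 2) * ∑ y, (√(a y) + √(b y)) ^ 2 := by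
        simpa only [sq_abs] using sum_mul_sq_le_sq_mul_sq univ (fun y => |√(a y) - √(b y)|) _
    _ ≤ (∑ y, (√(a y) - √(b y)) ^ 2) * 4 := by gcongr
    _ = 4 * ∑ y, (√(a y) - √(b y)) ^ 2 := mul_comm _ _

lemma sq_l1_sub_le_relEnt (ha : a ∈ stdSimplex ℝ S) (hb : b ∈ stdSimplex ℝ S)
    (hab : ∀ y, b y = 0 → a y = 0) : l1 (a - b) ^ 2 ≤ 4 * relEnt a b :=
  (sq_l1_sub_le_sum_sq_sqrt_sub_sqrt ha hb).trans
    (mul_le_mul_of_nonneg_left (sum_sq_sqrt_sub_sqrt_le_relEnt ha hb hab) (by norm_num))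

variable {X A : Type*}

lemma push_eq_zero_of_push_eq_zero {k : S → X → ℝ} (hb : ∀ y, 0 ≤ b y) (hk : ∀ y x, 0 ≤ k y x)
    (hab : ∀ y, b y = 0 → a y = 0) {x : X} (hx : push b k x = 0) : push a k x = 0 := by
  refine sum_eq_zero fun y hy => ?_
  rcases mul_eq_zero.1 ((sum_eq_zero_iff_of_nonneg fun y _ => mul_nonneg (hb y) (hk y x)).1 hx y hy)
    with hby | hky
  · rw [hab y hby, zero_mul]
  · rw [hky, mul_zero]

lemma joint_eq_zero_of_joint_eq_zero {m m' : X → ℝ} {σ σ' : X → A → ℝ}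
    (hm : ∀ x, m' x = 0 → m x = 0) (hσ : ∀ x a, σ' x a = 0 → σ x a = 0) {z : X × A}
    (hz : joint m' σ' z = 0) : joint m σ z = 0 := by
  rcases mul_eq_zero.1 hz with h | h
  · exact mul_eq_zero_of_left (hm _ h) _
  · exact mul_eq_zero_of_right _ (hσ _ _ h)

variable [Fintype X]

lemma relEnt_push_le {k : S → X → ℝ} (ha : ∀ y, 0 ≤ a y) (hb : ∀ y, 0 ≤ b y)
    (hab : ∀ y, b y = 0 → a y = 0) (hk : ∀ y, k y ∈ stdSimplex ℝ X) :
    relEnt (push a k) (push b k) ≤ relEnt a b := by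
  have hstate (x : X) : push a k x * (Real.log (push a k x) - Real.log (push b k x)) ≤
      ∑ y, a y * (Real.log (a y) - Real.log (b y)) * k y x := by
    refine (log_sum_le (fun y => mul_nonneg (ha y) ((hk y).1 x))
      (fun y => mul_nonneg (hb y) ((hk y).1 x)) fun y hy => ?_).trans_eq
      (sum_congr rfl fun y _ => ?_)
    · exact (mul_eq_zero.1 hy).elim (fun h => by rw [hab y h, zero_mul])
        fun h => by rw [h, mul_zero]
    · by_cases hay : a y = 0
      · simp [hay]
      by_cases hky : k y x = 0
      · simp [hky]
      rw [Real.log_mul hay hky, Real.log_mul (fun h => hay (hab y h)) hky]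
      ring
  refine (sum_le_sum fun x _ => hstate x).trans_eq ?_
  rw [sum_comm]
  simp only [← mul_sum, (hk _).2, mul_one]
  rfl

variable [Fintype A]

lemma relEnt_joint {m m' : X → ℝ} {σ σ' : X → A → ℝ} (hm : ∀ x, m' x = 0 → m x = 0)
    (hσ : ∀ x, σ x ∈ stdSimplex ℝ A) (hσσ' : ∀ x a, σ' x a = 0 → σ x a = 0) :
    relEnt (joint m σ) (joint m' σ') = relEnt m m' + ∑ x, m x * relEnt (σ x) (σ' x) := by
  have hterm (x : X) (a : A) :
      joint m σ (x, a) * (Real.log (joint m σ (x, a)) - Real.log (joint m' σ' (x, a))) =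
        m x * (Real.log (m x) - Real.log (m' x)) * σ x a +
          m x * (σ x a * (Real.log (σ x a) - Real.log (σ' x a))) := by
    simp only [joint]
    by_cases hmx : m x = 0
    · simp [hmx]
    by_cases hσx : σ x a = 0
    · simp [hσx]
    rw [Real.log_mul hmx hσx, Real.log_mul (fun h => hmx (hm x h)) (fun h => hσx (hσσ' x a h))]
    ring
  simp only [relEnt, Fintype.sum_prod_type, hterm, sum_add_distrib, ← mul_sum, (hσ _).2, mul_one]

lemma sum_log_sub_log_mul_joint (m : X → ℝ) (σ σ' : X → A → ℝ) :
    ∑ z : X × A, (Real.log (σ z.1 z.2) - Real.log (σ' z.1 z.2)) * joint m σ z =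
      ∑ x, m x * relEnt (σ x) (σ' x) := by
  simp only [Fintype.sum_prod_type, relEnt, mul_sum, joint]
  exact sum_congr rfl fun x _ => sum_congr rfl fun a _ => by ring

variable {N : ℕ} {p : Fin N → X × A → X → ℝ} {π π' : Fin N → X → A → ℝ} {ν : X × A → ℝ}

lemma occ_eq_zero_of_occ_eq_zero (hp : IsKernel p) (hπ' : IsPolicy π')
    (hac : ∀ i x a, π' i x a = 0 → π i x a = 0) (hν : ν ∈ stdSimplex ℝ (X × A))
    (n : Fin (N + 1)) (y : X × A) (hy : occ p π' ν n y = 0) : occ p π ν n y = 0 := by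
  induction n using Fin.induction generalizing y with
  | zero => exact hy
  | succ i ih =>
    rw [occ_succ] at hy ⊢
    exact joint_eq_zero_of_joint_eq_zero (fun x => push_eq_zero_of_push_eq_zero
      (occ_mem_stdSimplex hp hπ' hν _).1 (fun y => (hp i y).1) ih) (hac i) hy

lemma relEnt_occ_le (hp : IsKernel p) (hπ : IsPolicy π) (hπ' : IsPolicy π')
    (hac : ∀ i x a, π' i x a = 0 → π i x a = 0) (hν : ν ∈ stdSimplex ℝ (X × A))
    (n : Fin (N + 1)) :
    relEnt (occ p π ν n) (occ p π' ν n) ≤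
      pairing (fun i y => Real.log (π i y.1 y.2) - Real.log (π' i y.1 y.2)) (occ p π ν) := by
  have hocc (i : Fin N) := (occ_mem_stdSimplex hp hπ hν i.castSucc).1
  have hocc' (i : Fin N) := (occ_mem_stdSimplex hp hπ' hν i.castSucc).1
  have hzero (i : Fin N) := occ_eq_zero_of_occ_eq_zero hp hπ' hac hν i.castSucc
  simp only [pairing, occ_succ, sum_log_sub_log_mul_joint]
  refine (le_add_sum_of_succ_le (a := fun n => relEnt (occ p π ν n) (occ p π' ν n))
    (fun i => ?_) (fun i => ?_) n).trans_eq (add_eq_right.2 ?_)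
  · exact sum_nonneg fun x _ => mul_nonneg (push_nonneg (hocc i) (fun y => (hp i y).1) x)
      (relEnt_nonneg (hπ i x) (hπ' i x) (hac i x))
  · rw [occ_succ, occ_succ, relEnt_joint (fun x => push_eq_zero_of_push_eq_zero (hocc' i)
      (fun y => (hp i y).1) (hzero i)) (hπ i) (hac i)]
    exact add_le_add_left (relEnt_push_le (hocc i) (hocc' i) (hzero i) (hp i)) _
  · simp [relEnt, occ]

end RelativeEntropy

section FirstOrder

lemma nonneg_of_isMinOn_of_hasLineDerivAt {E : Type*} [AddCommGroup E] [Module ℝ E] {F : E → ℝ}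
    {C : Set E} (hC : Convex ℝ C) {u v : E} (hu : u ∈ C) (hv : v ∈ C) (hmin : IsMinOn F C u) {c : ℝ}
    (hF : HasLineDerivAt ℝ F c u (v - u)) : 0 ≤ c := by
  have hminIcc : IsMinOn (fun s : ℝ => F (u + s • (v - u))) (Set.Icc 0 1) 0 := fun s hs => by
    simpa using hmin (hC.add_smul_sub_mem hu hv hs)
  simpa using hminIcc.localize.hasFDerivWithinAt_nonneg hF.hasFDerivAt.hasFDerivWithinAt
    (sub_mem_posTangentConeAt_of_segment_subset (y := 1) (segment_eq_Icc zero_le_one).subset)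

lemma hasDerivAt_add_mul (u d : ℝ) : HasDerivAt (fun s : ℝ => u + s * d) d 0 := by
  simpa using ((hasDerivAt_id (0 : ℝ)).mul_const d).const_add u

lemma hasDerivAt_mul_log_div {u d M D c : ℝ} (hu : 0 < u) (hM : 0 < M) (hc : 0 < c) :
    HasDerivAt (fun s : ℝ => (u + s * d) * Real.log ((u + s * d) / (M + s * D) / c))
      ((Real.log (u / M) - Real.log c) * d + d - D * (u / M)) 0 := by
  have hlog := (((hasDerivAt_add_mul u d).fun_div (hasDerivAt_add_mul M D)
    (by simpa using hM.ne')).div_const c).log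
    (by simpa using ⟨⟨hu.ne', hM.ne'⟩, hc.ne'⟩)
  refine ((hasDerivAt_add_mul u d).fun_mul hlog).congr_deriv ?_
  simp only [zero_mul, add_zero]
  rw [Real.log_div (by positivity) hc.ne']
  field_simp
  ring

lemma hasDerivAt_sum_mul_log_conditional {A : Type*} [Fintype A] {u d σ σ' : A → ℝ}
    (hu : ∀ a, 0 ≤ u a) (hσ : ∀ a, u a = (∑ b, u b) * σ a) (hd : ∀ a, u a = 0 → d a = 0)
    (hpos : ∀ a, 0 < σ a) (hpos' : ∀ a, 0 < σ' a) :
    HasDerivAt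
      (fun s : ℝ => ∑ a, (u a + s * d a) *
        Real.log ((u a + s * d a) / (∑ b, u b + s * ∑ b, d b) / σ' a))
      (∑ a, (Real.log (σ a) - Real.log (σ' a)) * d a) 0 := by
  rcases (sum_nonneg fun b (_ : b ∈ univ) => hu b).eq_or_lt with hM | hM
  · have hu0 (a : A) : u a = 0 := by rw [hσ, ← hM, zero_mul]
    simp only [hu0, hd _ (hu0 _), mul_zero, add_zero, zero_mul, sum_const_zero]
    exact hasDerivAt_const _ _
  have hdiv (a : A) : u a / ∑ b, u b = σ a := by
    rw [div_eq_iff hM.ne', mul_comm]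
    exact hσ a
  have hsum : ∑ a, σ a = 1 := by simp only [← hdiv, ← sum_div, div_self hM.ne']
  refine (HasDerivAt.fun_sum fun a (_ : a ∈ (univ : Finset A)) =>
    hasDerivAt_mul_log_div (d := d a) (D := ∑ b, d b) (hσ a ▸ mul_pos hM (hpos a)) hM
      (hpos' a)).congr_deriv ?_
  simp only [hdiv, sum_sub_distrib, sum_add_distrib, ← mul_sum, hsum, mul_one, add_sub_cancel_right]

variable {X A : Type*} [Fintype X] [Fintype A] {N : ℕ}

lemma hasLineDerivAt_pairing (z : Fin N → X × A → ℝ) (μ d : Fin (N + 1) → X × A → ℝ) :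
    HasLineDerivAt ℝ (pairing z) (pairing z d) μ d := by
  have hlin (s : ℝ) : pairing z (μ + s • d) = pairing z μ + s * pairing z d := by
    simp only [pairing, mul_sum, ← sum_add_distrib, Pi.add_apply, Pi.smul_apply, smul_eq_mul]
    exact sum_congr rfl fun i _ => sum_congr rfl fun y _ => by ring
  simp only [HasLineDerivAt, hlin]
  exact hasDerivAt_add_mul _ _

lemma hasLineDerivAt_kl {μ μ' d : Fin (N + 1) → X × A → ℝ} {π π' : Fin N → X → A → ℝ}
    (hd0 : d 0 = 0) (hd : ∀ i : Fin N, ∑ y, d i.succ y = 0) (hreg : Div.kl.Regular μ π)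
    (hreg' : Div.kl.Regular μ' π') :
    HasLineDerivAt ℝ (fun ξ => Div.kl.val ξ μ' π')
      (pairing (Div.kl.grad μ π - Div.kl.grad μ' π') d) μ d := by
  have hterm (i : Fin N) (y : X × A) := hasDerivAt_mul_log_div (d := d i.succ y) (D := 0)
    (hreg i y) one_pos (hreg' i y)
  simp only [mul_zero, add_zero, div_one, zero_mul, sub_zero] at hterm
  have hsum := (HasDerivAt.fun_sum fun i (_ : i ∈ (univ : Finset (Fin N))) =>
    HasDerivAt.fun_sum fun y (_ : y ∈ (univ : Finset (X × A))) => hterm i y).const_add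
      (∑ y, μ 0 y * Real.log (μ 0 y / μ' 0 y))
  simp only [HasLineDerivAt, Div.val, Fin.sum_univ_succ (n := N), Pi.add_apply, Pi.smul_apply,
    hd0, Pi.zero_apply, mul_zero, add_zero, smul_eq_mul]
  simpa only [pairing, Div.grad, Pi.sub_apply, add_sub_add_right_eq_sub, sum_add_distrib, hd,
    add_zero] using hsum

lemma hasLineDerivAt_gamma {μ μ' d : Fin (N + 1) → X × A → ℝ} {π π' : Fin N → X → A → ℝ}
    (hd0 : d 0 = 0) (hμ : ∀ n y, 0 ≤ μ n y)
    (hπ : ∀ (i : Fin N) x a, μ i.succ (x, a) = (∑ b, μ i.succ (x, b)) * π i x a)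
    (hd : ∀ n y, μ n y = 0 → d n y = 0) (hreg : Div.gamma.Regular μ π)
    (hreg' : Div.gamma.Regular μ' π') :
    HasLineDerivAt ℝ (fun ξ => Div.gamma.val ξ μ' π')
      (pairing (Div.gamma.grad μ π - Div.gamma.grad μ' π') d) μ d := by
  have hsum := (HasDerivAt.fun_sum fun i (_ : i ∈ (univ : Finset (Fin N))) =>
    HasDerivAt.fun_sum fun x (_ : x ∈ (univ : Finset X)) =>
      hasDerivAt_sum_mul_log_conditional (fun a => hμ i.succ (x, a)) (hπ i x)
        (fun a => hd i.succ (x, a)) (hreg i x) (hreg' i x)).add_const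
      (∑ y, μ 0 y * Real.log (μ 0 y / μ' 0 y))
  simp only [HasLineDerivAt, Div.val, Pi.add_apply, Pi.smul_apply, hd0, smul_zero, Pi.zero_apply,
    add_zero, smul_eq_mul, sum_add_distrib, ← mul_sum]
  simpa only [pairing, Fintype.sum_prod_type, Div.grad, Pi.sub_apply, sum_add_distrib] using hsum

variable {p : Fin N → X × A → X → ℝ} {π π' σ : Fin N → X → A → ℝ} {ν : X × A → ℝ}
  {μ' : Fin (N + 1) → X × A → ℝ}

lemma hasLineDerivAt_val_occ {D : Div} (hp : IsKernel p) (hπ : IsPolicy π) (hσ : IsPolicy σ)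
    (hν : ν ∈ stdSimplex ℝ (X × A)) (hreg : D.Regular (occ p π ν) π) (hreg' : D.Regular μ' π') :
    HasLineDerivAt ℝ (fun ξ => D.val ξ μ' π')
      (pairing (D.grad (occ p π ν) π - D.grad μ' π') (occ p σ ν - occ p π ν))
      (occ p π ν) (occ p σ ν - occ p π ν) := by
  have hd0 : (occ p σ ν - occ p π ν) 0 = 0 := sub_self ν
  have hocc := occ_mem_stdSimplex hp hπ hν
  cases D with
  | kl =>
    refine hasLineDerivAt_kl hd0 (fun i => ?_) hreg hreg'
    simp only [Pi.sub_apply, sum_sub_distrib, (occ_mem_stdSimplex hp hσ hν _).2, (hocc _).2,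
      sub_self]
  | gamma =>
    refine hasLineDerivAt_gamma hd0 (fun n => (hocc n).1) (fun i x a => ?_) (fun n y hy => ?_)
      hreg hreg'
    · rw [sum_occ_succ hπ, occ_succ, joint]
    · have hy' := occ_eq_zero_of_occ_eq_zero hp hπ (π := σ)
        (fun i x a h => absurd h (hreg i x a).ne') hν n y hy
      rw [Pi.sub_apply, Pi.sub_apply, hy, hy', sub_self]

lemma occ_first_order {D : Div} {C : Set (Fin (N + 1) → X × A → ℝ)} {z : Fin N → X × A → ℝ} {η : ℝ}
    (hp : IsKernel p) (hπ : IsPolicy π) (hσ : IsPolicy σ) (hν : ν ∈ stdSimplex ℝ (X × A))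
    (hC : Convex ℝ C) (hπC : occ p π ν ∈ C) (hσC : occ p σ ν ∈ C)
    (hmin : IsMinOn (fun ξ => η * pairing z ξ + D.val ξ μ' π') C (occ p π ν))
    (hreg : D.Regular (occ p π ν) π) (hreg' : D.Regular μ' π') :
    0 ≤ η * pairing z (occ p σ ν - occ p π ν) +
      pairing (D.grad (occ p π ν) π - D.grad μ' π') (occ p σ ν - occ p π ν) :=
  nonneg_of_isMinOn_of_hasLineDerivAt hC hπC hσC hmin <|
    ((hasLineDerivAt_pairing z _ _).const_mul η).fun_add
      (hasLineDerivAt_val_occ hp hπ hσ hν hreg hreg')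

end FirstOrder

section Convexity

lemma convexOn_l1_sub {S : Type*} [Fintype S] (w : S → ℝ) :
    ConvexOn ℝ Set.univ fun v => l1 (v - w) := by
  refine ⟨convex_univ, fun u _ v _ s r hs hr hsr => ?_⟩
  have hcomb : s • u + r • v - w = s • (u - w) + r • (v - w) := by
    rw [smul_sub, smul_sub, ← add_sub_add_comm, ← add_smul, hsr, one_smul]
  dsimp only
  rw [hcomb, smul_eq_mul, smul_eq_mul]
  refine (l1_add_le _ _).trans_eq ?_
  rw [l1_smul, l1_smul, abs_of_nonneg hs, abs_of_nonneg hr]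

variable {X A : Type*} [Fintype X] [Fintype A] {N : ℕ}

lemma convex_flowSet (p : Fin N → X × A → X → ℝ) (ρ : X × A → ℝ) : Convex ℝ (flowSet p ρ) := by
  intro μ hμ μ' hμ' s r hs hr hsr
  refine ⟨fun n => (convex_stdSimplex ℝ _) (hμ.1 n) (hμ'.1 n) hs hr hsr, ?_, fun i x => ?_⟩
  · rw [Pi.add_apply, Pi.smul_apply, Pi.smul_apply, hμ.2.1, hμ'.2.1, ← add_smul, hsr, one_smul]
  · simp only [Pi.add_apply, Pi.smul_apply, smul_eq_mul, sum_add_distrib, ← mul_sum, hμ.2.2 i x,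
      hμ'.2.2 i x, add_mul, mul_assoc]

lemma convex_constraintSet (T : ℕ) (δ α : ℝ) (ρ ρt : X × A → ℝ) (h : ℕ → Fin (N + 1) → X × A)
    (t : ℕ) : Convex ℝ (constraintSet T δ α ρ ρt h t) := by
  intro μ hμ μ' hμ' s r hs hr hsr
  refine ⟨convex_flowSet _ _ hμ.1 hμ'.1 hs hr hsr, ?_⟩
  refine ((convexOn_l1_sub ρ).2 trivial trivial hs hr hsr).trans ?_
  refine (add_le_add (mul_le_mul_of_nonneg_left hμ.2 hs)
    (mul_le_mul_of_nonneg_left hμ'.2 hr)).trans_eq ?_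
  simp only [Pi.add_apply, Pi.smul_apply, smul_eq_mul, add_mul, sum_add_distrib, mul_assoc,
    ← mul_sum]
  linear_combination (α * l1 (ρt - ρ)) * hsr

end Convexity

section CondLaw

lemma sum_mul_exp_mul_sub_le {S : Type*} [Fintype S] {w : S → ℝ} (hw : w ∈ stdSimplex ℝ S)
    {v : S → ℝ} (hv : ∀ x, v x ∈ Set.Icc (-1 : ℝ) 1) (c : ℝ) :
    ∑ x, w x * Real.exp (c * (v x - ∑ y, w y * v y)) ≤ Real.exp (c ^ 2 / 2) := by
  let _ : MeasurableSpace S := ⊤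
  let q : PMF S := PMF.ofFintype (fun x => ENNReal.ofReal (w x)) (by
    rw [← ENNReal.ofReal_sum_of_nonneg fun x _ => hw.1 x, hw.2, ENNReal.ofReal_one])
  have hq (f : S → ℝ) : ∫ x, f x ∂q.toMeasure = ∑ x, w x * f x := by
    rw [PMF.integral_eq_sum]
    refine sum_congr rfl fun x _ => ?_
    rw [PMF.ofFintype_apply, ENNReal.toReal_ofReal (hw.1 x), smul_eq_mul]
  have hmgf := (hasSubgaussianMGF_of_mem_Icc (μ := q.toMeasure) (X := v)
    (measurable_of_finite v).aemeasurable (Filter.Eventually.of_forall hv)).mgf_le c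
  rw [mgf, hq, hq] at hmgf
  refine hmgf.trans_eq ?_
  norm_num

lemma apply_eq_sum_mul_indicator {Ω S : Type*} [Fintype S] (Y : Ω → S) (V : Ω → S → ℝ) (ω : Ω) :
    V ω (Y ω) = ∑ s, V ω s * Set.indicator {ω | Y ω = s} (fun _ => (1 : ℝ)) ω := by
  classical
  simp only [Set.indicator_apply, Set.mem_ofPred_eq, mul_ite, mul_one, mul_zero, sum_ite_eq,
    mem_univ, if_true]

lemma measurable_apply {Ω S : Type*} [Finite S] {m : MeasurableSpace Ω} {Y : Ω → S}
    {V : Ω → S → ℝ} (hY : ∀ s, MeasurableSet {ω | Y ω = s}) (hV : ∀ s, Measurable fun ω => V ω s) :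
    Measurable fun ω => V ω (Y ω) := by
  have := Fintype.ofFinite S
  simp only [apply_eq_sum_mul_indicator Y V]
  exact Finset.measurable_sum _ fun s _ => (hV s).mul (measurable_const.indicator (hY s))

variable {Ω S : Type*} [Fintype S] {m mΩ : MeasurableSpace Ω} {P : Measure Ω}

lemma integral_apply_eq_integral_sum [IsFiniteMeasure P] (hm : m ≤ mΩ) {Y : Ω → S}
    {q V : Ω → S → ℝ} {B : ℝ} (hY : ∀ s, MeasurableSet {ω | Y ω = s})
    (hq : ∀ s, P[Set.indicator {ω | Y ω = s} (fun _ => (1 : ℝ)) | m] =ᵐ[P] fun ω => q ω s)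
    (hV : ∀ s, Measurable[m] fun ω => V ω s) (hB : ∀ ω s, |V ω s| ≤ B) :
    Integrable (fun ω => ∑ s, V ω s * q ω s) P ∧
      ∫ ω, V ω (Y ω) ∂P = ∫ ω, ∑ s, V ω s * q ω s ∂P := by
  have hind (s : S) : Integrable (Set.indicator {ω | Y ω = s} fun _ => (1 : ℝ)) P :=
    (integrable_const _).indicator (hY s)
  have hint (s : S) :
      Integrable ((fun ω => V ω s) * Set.indicator {ω | Y ω = s} fun _ => (1 : ℝ)) P :=
    (hind s).bdd_mul ((hV s).mono hm le_rfl).aestronglyMeasurable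
      (Filter.Eventually.of_forall fun ω => hB ω s)
  have hcond (s : S) :
      P[(fun ω => V ω s) * Set.indicator {ω | Y ω = s} (fun _ => (1 : ℝ)) | m] =ᵐ[P]
        fun ω => V ω s * q ω s :=
    (condExp_mul_of_stronglyMeasurable_left (hV s).stronglyMeasurable (hint s) (hind s)).trans
      (Filter.EventuallyEq.rfl.mul (hq s))
  have hintq (s : S) : Integrable (fun ω => V ω s * q ω s) P := integrable_condExp.congr (hcond s)
  refine ⟨integrable_finsetSum _ fun s _ => hintq s, ?_⟩
  simp only [apply_eq_sum_mul_indicator Y V]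
  rw [integral_finsetSum _ fun s _ => hintq s]
  refine (integral_finsetSum _ fun s _ => hint s).trans ?_
  refine sum_congr rfl fun s _ => ?_
  rw [← integral_congr_ae (hcond s), integral_condExp hm]

/-- `τ t` is `ℱ (t + 1)`-measurable, with conditional law `q t` given `ℱ t`, for all `t < T`. -/
structure HasCondLaws (P : Measure Ω) (ℱ : Filtration ℕ mΩ) (T : ℕ) (τ : ℕ → Ω → S)
    (q : ℕ → Ω → S → ℝ) : Prop where
  measurableSet_eq : ∀ t < T, ∀ s, MeasurableSet[ℱ (t + 1)] {ω | τ t ω = s}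
  condExp_indicator : ∀ t < T, ∀ s,
    P[Set.indicator {ω | τ t ω = s} (fun _ => (1 : ℝ)) | ℱ t] =ᵐ[P] fun ω => q t ω s

/-- Bounded non-negative predictable weights whose conditional mean under the laws `q` is at most
one; their running products along the observations are supermartingales. -/
structure IsSubunitWeight (ℱ : Filtration ℕ mΩ) (T : ℕ) (q W : ℕ → Ω → S → ℝ) (B : ℝ) : Prop where
  measurable : ∀ t < T, ∀ s, Measurable[ℱ t] fun ω => W t ω s
  nonneg : ∀ t < T, ∀ ω s, 0 ≤ W t ω s
  le : ∀ t < T, ∀ ω s, W t ω s ≤ B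
  sum_mul_le_one : ∀ t < T, ∀ ω, ∑ s, W t ω s * q t ω s ≤ 1

variable {ℱ : Filtration ℕ mΩ} {T : ℕ} {τ : ℕ → Ω → S} {q W : ℕ → Ω → S → ℝ} {B : ℝ}

namespace IsSubunitWeight

lemma prod_nonneg (hW : IsSubunitWeight ℱ T q W B) {n : ℕ} (hn : n ≤ T) (ω : Ω) :
    0 ≤ ∏ t ∈ range n, W t ω (τ t ω) :=
  Finset.prod_nonneg fun t ht => hW.nonneg t ((mem_range.1 ht).trans_le hn) ω _

lemma abs_prod_le (hW : IsSubunitWeight ℱ T q W B) {n : ℕ} (hn : n ≤ T) (ω : Ω) :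
    |∏ t ∈ range n, W t ω (τ t ω)| ≤ B ^ n := by
  have hlt {t : ℕ} (ht : t ∈ range n) : t < T := (mem_range.1 ht).trans_le hn
  rw [abs_of_nonneg (hW.prod_nonneg hn ω)]
  exact (prod_le_prod (fun t ht => hW.nonneg t (hlt ht) ω _)
    fun t ht => hW.le t (hlt ht) ω _).trans_eq (by rw [prod_const, card_range])

lemma measurable_prod (hW : IsSubunitWeight ℱ T q W B) (hτ : HasCondLaws P ℱ T τ q) {n : ℕ}
    (hn : n ≤ T) : Measurable[ℱ n] fun ω => ∏ t ∈ range n, W t ω (τ t ω) := by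
  refine Finset.measurable_prod _ fun t ht => ?_
  have htn := mem_range.1 ht
  exact measurable_apply (fun s => ℱ.mono htn _ (hτ.measurableSet_eq t (htn.trans_le hn) s))
    fun s => (hW.measurable t (htn.trans_le hn) s).mono (ℱ.mono htn.le) le_rfl

variable [IsProbabilityMeasure P]

lemma integrable_prod (hW : IsSubunitWeight ℱ T q W B) (hτ : HasCondLaws P ℱ T τ q) {n : ℕ}
    (hn : n ≤ T) : Integrable (fun ω => ∏ t ∈ range n, W t ω (τ t ω)) P :=
  .of_bound ((hW.measurable_prod hτ hn).mono (ℱ.le n) le_rfl).aestronglyMeasurable _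
    (Filter.Eventually.of_forall (hW.abs_prod_le hn))

lemma integral_prod_le_one (hW : IsSubunitWeight ℱ T q W B) (hτ : HasCondLaws P ℱ T τ q) {n : ℕ}
    (hn : n ≤ T) : ∫ ω, ∏ t ∈ range n, W t ω (τ t ω) ∂P ≤ 1 := by
  induction n with
  | zero => simp
  | succ n ih =>
    have hn' : n ≤ T := Nat.le_of_succ_le hn
    obtain ⟨hint, heq⟩ := integral_apply_eq_integral_sum (ℱ.le n)
      (V := fun ω s => (∏ t ∈ range n, W t ω (τ t ω)) * W n ω s) (B := B ^ n * B)
      (fun s => ℱ.le _ _ (hτ.measurableSet_eq n hn s)) (hτ.condExp_indicator n hn)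
      (fun s => (hW.measurable_prod hτ hn').mul (hW.measurable n hn s)) fun ω s => by
        have hprod := hW.abs_prod_le (τ := τ) hn' ω
        rw [abs_mul, abs_of_nonneg (hW.nonneg n hn ω s)]
        exact mul_le_mul hprod (hW.le n hn ω s) (hW.nonneg n hn ω s)
          ((abs_nonneg _).trans hprod)
    simp only [prod_range_succ]
    rw [heq]
    refine (integral_mono hint (hW.integrable_prod hτ hn') fun ω => ?_).trans (ih hn')
    simp only [mul_assoc, ← mul_sum]
    exact mul_le_of_le_one_right (hW.prod_nonneg hn' ω) (hW.sum_mul_le_one n hn ω)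

lemma measureReal_exp_le_prod_le (hW : IsSubunitWeight ℱ T q W B) (hτ : HasCondLaws P ℱ T τ q)
    {n : ℕ} (hn : n ≤ T) (a : ℝ) :
    P.real {ω | Real.exp a ≤ ∏ t ∈ range n, W t ω (τ t ω)} ≤ Real.exp (-a) := by
  have hmarkov := (mul_meas_ge_le_integral_of_nonneg
    (Filter.Eventually.of_forall (hW.prod_nonneg hn)) (hW.integrable_prod hτ hn)
    (Real.exp a)).trans (hW.integral_prod_le_one hτ hn)
  rw [Real.exp_neg, ← one_div, le_div_iff₀ (Real.exp_pos a), mul_comm]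
  exact hmarkov

end IsSubunitWeight

lemma exp_neg_le_one_sub_half {x : ℝ} (hx : x ∈ Set.Icc (0 : ℝ) 1) :
    Real.exp (-x) ≤ 1 - x / 2 := by
  rw [Real.exp_neg, inv_le_comm₀ (Real.exp_pos x) (by linarith [hx.2])]
  calc (1 - x / 2)⁻¹ ≤ 1 + x := by
        rw [inv_le_iff_one_le_mul₀ (by linarith [hx.2])]
        nlinarith [mul_nonneg hx.1 (sub_nonneg.2 hx.2)]
    _ ≤ Real.exp x := by linarith [Real.add_one_le_exp x]

lemma sum_exp_half_sub_mul_le_one {w : S → ℝ} (hw : w ∈ stdSimplex ℝ S) {φ : S → ℝ}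
    (hφ : ∀ s, φ s ∈ Set.Icc (0 : ℝ) 1) :
    ∑ s, Real.exp ((∑ r, w r * φ r) / 2 - φ s) * w s ≤ 1 := by
  set M := ∑ r, w r * φ r with hM
  have hexp : ∑ s, Real.exp (-φ s) * w s ≤ Real.exp (-(M / 2)) := calc
    ∑ s, Real.exp (-φ s) * w s ≤ ∑ s, (1 - φ s / 2) * w s :=
      sum_le_sum fun s _ => mul_le_mul_of_nonneg_right (exp_neg_le_one_sub_half (hφ s)) (hw.1 s)
    _ = -(M / 2) + 1 := by
      simp only [sub_mul, one_mul, sum_sub_distrib, hw.2, hM, sum_div, mul_comm (w _),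
        mul_div_right_comm]
      ring
    _ ≤ Real.exp (-(M / 2)) := Real.add_one_le_exp _
  calc ∑ s, Real.exp (M / 2 - φ s) * w s = Real.exp (M / 2) * ∑ s, Real.exp (-φ s) * w s := by
        simp only [sub_eq_add_neg, Real.exp_add, mul_sum, mul_assoc]
    _ ≤ Real.exp (M / 2) * Real.exp (-(M / 2)) :=
        mul_le_mul_of_nonneg_left hexp (Real.exp_pos _).le
    _ = 1 := by rw [← Real.exp_add, add_neg_cancel, Real.exp_zero]

lemma isSubunitWeight_exp {φ : ℕ → Ω → S → ℝ} (hq : ∀ t < T, ∀ ω, q t ω ∈ stdSimplex ℝ S)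
    (hqm : ∀ t < T, ∀ s, Measurable[ℱ t] fun ω => q t ω s)
    (hφm : ∀ t < T, ∀ s, Measurable[ℱ t] fun ω => φ t ω s)
    (hφ : ∀ t ω s, φ t ω s ∈ Set.Icc (0 : ℝ) 1) :
    IsSubunitWeight ℱ T q
      (fun t ω s => Real.exp ((∑ r, q t ω r * φ t ω r) / 2 - φ t ω s)) (Real.exp 1) where
  measurable t ht s := Real.measurable_exp.comp
    (((Finset.measurable_sum _ fun r _ => (hqm t ht r).mul (hφm t ht r)).div_const 2).sub
      (hφm t ht s))
  nonneg _ _ _ _ := (Real.exp_pos _).le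
  le t ht ω s := by
    have hmean : ∑ r, q t ω r * φ t ω r ≤ 1 := (hq t ht ω).2 ▸
      sum_le_sum fun r _ => mul_le_of_le_one_right ((hq t ht ω).1 r) (hφ t ω r).2
    exact Real.exp_le_exp.2 (by linarith [(hφ t ω s).1])
  sum_mul_le_one t ht ω := sum_exp_half_sub_mul_le_one (hq t ht ω) (hφ t ω)

lemma measureReal_sum_condMean_ge_le [IsProbabilityMeasure P] {φ : ℕ → Ω → S → ℝ} {b : ℝ}
    (hb : 0 < b) (hτ : HasCondLaws P ℱ T τ q) (hq : ∀ t < T, ∀ ω, q t ω ∈ stdSimplex ℝ S)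
    (hqm : ∀ t < T, ∀ s, Measurable[ℱ t] fun ω => q t ω s)
    (hφm : ∀ t < T, ∀ s, Measurable[ℱ t] fun ω => φ t ω s)
    (hφ : ∀ t ω s, φ t ω s ∈ Set.Icc 0 b) (a : ℝ) :
    P.real {ω | 2 * (∑ t ∈ range T, φ t ω (τ t ω) + b * a) ≤
      ∑ t ∈ range T, ∑ s, q t ω s * φ t ω s} ≤ Real.exp (-a) := by
  have hscaled := (isSubunitWeight_exp hq hqm (fun t ht s => (hφm t ht s).div_const b)
    fun t ω s => ⟨div_nonneg (hφ t ω s).1 hb.le, (div_le_one hb).2 (hφ t ω s).2⟩)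
  refine le_of_eq_of_le ?_ (hscaled.measureReal_exp_le_prod_le hτ le_rfl a)
  congr! 3 with ω
  rw [← Real.exp_sum, Real.exp_le_exp]
  simp only [mul_div_assoc', ← sum_div, sum_sub_distrib]
  rw [div_div, mul_comm b 2, ← mul_div_mul_left _ b (two_ne_zero' ℝ), ← sub_div,
    le_div_iff₀ (mul_pos two_pos hb), le_sub_iff_add_le]
  exact iff_of_eq (congrArg (· ≤ _) (by ring))

end CondLaw

section Trajectories

variable {X A : Type*} {N : ℕ}

lemma sum_fin_cons {S M : Type*} [Fintype S] [AddCommMonoid M] {n : ℕ}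
    (f : (Fin (n + 1) → S) → M) : ∑ τ, f τ = ∑ y, ∑ τ : Fin n → S, f (Fin.cons y τ) := by
  rw [← (Fin.consEquiv fun _ : Fin (n + 1) => S).sum_comp, Fintype.sum_prod_type]
  rfl

lemma pathProb_cons (p : Fin (N + 1) → X × A → X → ℝ) (π : Fin (N + 1) → X → A → ℝ)
    (ν : X × A → ℝ) (y : X × A) (τ : Fin (N + 1) → X × A) :
    pathProb p π ν (Fin.cons y τ : Fin (N + 2) → X × A) =
      pathProb (Fin.tail p) (Fin.tail π) (joint (fun x => ν y * p 0 y x) (π 0)) τ := by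
  rw [pathProb, Fin.prod_univ_succ]
  simp only [Fin.cons_zero, Fin.cons_succ, Fin.castSucc_zero, ← Fin.succ_castSucc, pathProb, joint,
    Fin.tail]
  ring

lemma IsKernel.tail [Fintype X] {p : Fin (N + 1) → X × A → X → ℝ} (hp : IsKernel p) :
    IsKernel (Fin.tail p) :=
  fun i => hp i.succ

lemma IsPolicy.tail [Fintype A] {π : Fin (N + 1) → X → A → ℝ} (hπ : IsPolicy π) :
    IsPolicy (Fin.tail π) :=
  fun i => hπ i.succ

variable [Fintype X] [Fintype A] {p : Fin N → X × A → X → ℝ} {π : Fin N → X → A → ℝ}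

lemma sum_joint_mul (m : X → ℝ) {σ : X → A → ℝ} (hσ : ∀ x, σ x ∈ stdSimplex ℝ A) (f : X → ℝ) :
    ∑ z, joint m σ z * f z.1 = ∑ x, m x * f x := by
  simp only [Fintype.sum_prod_type, ← sum_mul, sum_joint m (hσ _)]

lemma occ_succ_eq_occ_tail (p : Fin (N + 1) → X × A → X → ℝ) (π : Fin (N + 1) → X → A → ℝ)
    (ν : X × A → ℝ) (n : Fin (N + 1)) :
    occ p π ν n.succ = occ (Fin.tail p) (Fin.tail π) (joint (push ν (p 0)) (π 0)) n := by
  induction n using Fin.induction with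
  | zero => exact occ_succ p π ν 0
  | succ i ih => rw [occ_succ, occ_succ, ← ih, Fin.succ_castSucc, Fin.tail, Fin.tail]

lemma pathProb_nonneg (hp : IsKernel p) (hπ : IsPolicy π) {ν : X × A → ℝ} (hν : ∀ y, 0 ≤ ν y)
    (τ : Fin (N + 1) → X × A) : 0 ≤ pathProb p π ν τ :=
  mul_nonneg (hν _) (prod_nonneg fun i _ => mul_nonneg ((hp i _).1 _) ((hπ i _).1 _))

lemma sum_pathProb (hp : IsKernel p) (hπ : IsPolicy π) (ν : X × A → ℝ) :
    ∑ τ, pathProb p π ν τ = ∑ y, ν y := by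
  induction N generalizing ν with
  | zero =>
    rw [sum_fin_cons]
    simp [pathProb]
  | succ N ih =>
    rw [sum_fin_cons]
    refine sum_congr rfl fun y _ => ?_
    simp only [pathProb_cons]
    rw [ih hp.tail hπ.tail]
    simp only [Fintype.sum_prod_type, sum_joint _ (hπ 0 _), ← mul_sum, (hp 0 y).2, mul_one]

lemma sum_pathProb_mul_apply_zero (hp : IsKernel p) (hπ : IsPolicy π) (ν f : X × A → ℝ) :
    ∑ τ, pathProb p π ν τ * f (τ 0) = ∑ y, ν y * f y := by
  rw [← sum_pathProb hp hπ fun y => ν y * f y]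
  exact sum_congr rfl fun τ _ => mul_right_comm _ _ _

lemma sum_pathProb_transition (hp : IsKernel p) (hπ : IsPolicy π) (ν : X × A → ℝ) (i : Fin N)
    (f : X × A → X → ℝ) :
    ∑ τ, pathProb p π ν τ * f (τ i.castSucc) (τ i.succ).1 =
      ∑ y, occ p π ν i.castSucc y * ∑ x, p i y x * f y x := by
  induction N generalizing ν with
  | zero => exact i.elim0
  | succ N ih =>
    rw [sum_fin_cons]
    simp only [pathProb_cons]
    cases i using Fin.cases with
    | zero =>
      refine sum_congr rfl fun y _ => ?_
      refine (sum_pathProb_mul_apply_zero hp.tail hπ.tail _ fun z => f y z.1).trans ?_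
      rw [sum_joint_mul _ (hπ 0), mul_sum]
      exact sum_congr rfl fun x _ => mul_assoc _ _ _
    | succ j =>
      rw [sum_comm, ← Fin.succ_castSucc, occ_succ_eq_occ_tail]
      refine (sum_congr rfl fun τ _ => ?_).trans (ih hp.tail hπ.tail (joint (push ν (p 0)) (π 0)) j)
      simp only [Fin.cons_succ, pathProb, joint, push, sum_mul]

end Trajectories

section Observations

variable {X A : Type*} {N T : ℕ} {Ω : Type*} {p : Fin N → X × A → X → ℝ}
  {ρ : X × A → ℝ} {traj : ℕ → Ω → Fin (N + 1) → X × A} {pol : ℕ → Ω → Fin N → X → A → ℝ}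

lemma measurable_visits [Finite X] [Finite A] {m : MeasurableSpace Ω} {t : ℕ}
    (h : ∀ s < t, ∀ τ, MeasurableSet[m] {ω | traj s ω = τ}) (n : Fin (N + 1)) (y : X × A) :
    Measurable[m] fun ω => visits (traj · ω) t n y := by
  classical
  induction t with
  | zero => simp [visits]
  | succ t ih =>
    simp only [visits_succ]
    refine (ih fun s hs => h s (by lia)).add (Measurable.ite ?_ measurable_const measurable_const)
    have hunion : {ω | traj t ω n = y} = ⋃ τ ∈ {τ : Fin (N + 1) → X × A | τ n = y},
        {ω | traj t ω = τ} := by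
      ext ω
      simp
    rw [hunion]
    exact MeasurableSet.biUnion (Set.to_countable _) fun τ _ => h t (by lia) τ

lemma measurable_pathProb {m : MeasurableSpace Ω} (p : Fin N → X × A → X → ℝ)
    {π : Ω → Fin N → X → A → ℝ} {ν : Ω → X × A → ℝ} (hπ : Measurable π) (hν : Measurable ν)
    (τ : Fin (N + 1) → X × A) : Measurable fun ω => pathProb p (π ω) (ν ω) τ := by
  unfold pathProb
  fun_prop

variable [Fintype X] [Fintype A]

lemma measurable_occ {m : MeasurableSpace Ω} (p : Fin N → X × A → X → ℝ)
    {π : Ω → Fin N → X → A → ℝ} {ν : Ω → X × A → ℝ} (hπ : Measurable π) (hν : Measurable ν)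
    (n : Fin (N + 1)) : Measurable fun ω => occ p (π ω) (ν ω) n := by
  induction n using Fin.induction with
  | zero => exact hν
  | succ i ih =>
    refine measurable_pi_lambda _ fun z => ?_
    simp only [occ_succ, joint, push]
    fun_prop

lemma measurable_initDist {m : MeasurableSpace Ω} (p : Fin N → X × A → X → ℝ) (ρ : X × A → ℝ)
    {t : ℕ} (h : ∀ s < t, Measurable (pol s)) : Measurable fun ω => initDist p ρ (pol · ω) t := by
  induction t with
  | zero => exact measurable_const
  | succ t ih => exact measurable_occ p (h t (by lia)) (ih fun s hs => h s (by lia)) (Fin.last N)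

variable [mΩ : MeasurableSpace Ω] {P : Measure Ω} {ℱ : Filtration ℕ mΩ}

namespace IsObservation

lemma hasCondLaws (hobs : IsObservation P ℱ T p ρ traj pol) :
    HasCondLaws P ℱ T traj fun t ω => pathProb p (pol t ω) (initDist p ρ (pol · ω) t) :=
  ⟨hobs.measurable_traj, hobs.condLaw⟩

lemma measurable_initDist (hobs : IsObservation P ℱ T p ρ traj pol) {t : ℕ} (ht : t ≤ T) :
    Measurable[ℱ t] fun ω => initDist p ρ (pol · ω) t :=
  PeriodicMDP.measurable_initDist p ρ fun s hs =>
    (hobs.measurable_pol s (hs.trans_le ht)).mono (ℱ.mono hs.le) le_rfl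

lemma measurable_visits (hobs : IsObservation P ℱ T p ρ traj pol) {t : ℕ} (ht : t ≤ T)
    (n : Fin (N + 1)) (y : X × A) : Measurable[ℱ t] fun ω => visits (traj · ω) t n y :=
  PeriodicMDP.measurable_visits
    (fun s hs τ => ℱ.mono hs _ (hobs.measurable_traj s (hs.trans_le ht) τ)) n y

lemma initDist_mem_stdSimplex (hobs : IsObservation P ℱ T p ρ traj pol) (hp : IsKernel p)
    (hρ : ρ ∈ stdSimplex ℝ (X × A)) {t : ℕ} (ht : t ≤ T) (ω : Ω) :
    initDist p ρ (pol · ω) t ∈ stdSimplex ℝ (X × A) :=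
  PeriodicMDP.initDist_mem_stdSimplex hp hρ (fun s hs => hobs.isPolicy s hs ω) ht

lemma pathProb_mem_stdSimplex (hobs : IsObservation P ℱ T p ρ traj pol) (hp : IsKernel p)
    (hρ : ρ ∈ stdSimplex ℝ (X × A)) {t : ℕ} (ht : t < T) (ω : Ω) :
    pathProb p (pol t ω) (initDist p ρ (pol · ω) t) ∈ stdSimplex ℝ (Fin (N + 1) → X × A) := by
  have hν := hobs.initDist_mem_stdSimplex hp hρ ht.le ω
  exact ⟨pathProb_nonneg hp (hobs.isPolicy t ht ω) hν.1,
    (sum_pathProb hp (hobs.isPolicy t ht ω) _).trans hν.2⟩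

lemma measurable_pathProb (hobs : IsObservation P ℱ T p ρ traj pol) {t : ℕ}
    (ht : t < T) (τ : Fin (N + 1) → X × A) :
    Measurable[ℱ t] fun ω => pathProb p (pol t ω) (initDist p ρ (pol · ω) t) τ :=
  PeriodicMDP.measurable_pathProb p (hobs.measurable_pol t ht) (hobs.measurable_initDist ht.le) τ

lemma measurable_invSqrtVisits (hobs : IsObservation P ℱ T p ρ traj pol) {t : ℕ}
    (ht : t ≤ T) (n : Fin (N + 1)) (y : X × A) :
    Measurable[ℱ t] fun ω => invSqrtVisits (traj · ω) t n y :=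
  (measurable_of_countable fun k : ℕ => 1 / √(max 1 (k : ℝ))).comp (hobs.measurable_visits ht n y)

end IsObservation

end Observations

section KernelConcentration

variable {X A : Type*} [Fintype X] {N T : ℕ}

lemma sum_ite_eq_sum_transitions (h : ℕ → Fin (N + 1) → X × A) (t : ℕ) (i : Fin N) (y : X × A)
    [∀ s, Decidable (h s i.castSucc = y)] (f : X → ℝ) :
    ∑ s ∈ range t, (if h s i.castSucc = y then f (h s i.succ).1 else 0) =
      ∑ x, transitions h t i y x * f x := by
  classical
  induction t with
  | zero => simp [transitions]
  | succ t ih =>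
    rw [sum_range_succ, ih]
    by_cases hy : h t i.castSucc = y <;>
      simp [hy, transitions_succ, add_mul, sum_add_distrib]

/-- Hoeffding's log-likelihood of an outcome drawn from `w`, along `v : X → [-1, 1]` with
parameter `c`. -/
noncomputable def hoeffdingLog (w v : X → ℝ) (c : ℝ) (x : X) : ℝ :=
  c * (v x - ∑ z, w z * v z) - c ^ 2 / 2

lemma sum_mul_exp_hoeffdingLog_le_one {w v : X → ℝ} (hw : w ∈ stdSimplex ℝ X)
    (hv : ∀ x, v x ∈ Set.Icc (-1 : ℝ) 1) (c : ℝ) :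
    ∑ x, w x * Real.exp (hoeffdingLog w v c x) ≤ 1 := by
  simp only [hoeffdingLog, Real.exp_sub _ (c ^ 2 / 2), ← mul_div_assoc, ← sum_div]
  exact (div_le_one (Real.exp_pos _)).2 (sum_mul_exp_mul_sub_le hw hv c)

lemma sum_mul_hoeffdingLog {u : X → ℝ} (hu : ∑ x, u x = 1) (w v : X → ℝ) (c : ℝ) :
    ∑ x, u x * hoeffdingLog w v c x = c * ∑ x, v x * (u x - w x) - c ^ 2 / 2 := by
  simp only [hoeffdingLog, mul_sub, sum_sub_distrib, ← sum_mul, hu, one_mul, mul_left_comm (u _) c,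
    ← mul_sum, mul_comm (u _) (v _), mul_comm (w _) (v _)]

/-- The vector of signs coded by `b`. -/
def signVec {S : Type*} (b : S → Bool) (x : S) : ℝ := if b x then 1 else -1

lemma signVec_mem_Icc {S : Type*} (b : S → Bool) (x : S) : signVec b x ∈ Set.Icc (-1 : ℝ) 1 := by
  unfold signVec
  split_ifs <;> norm_num

lemma l1_le_of_forall_signVec {w : X → ℝ} {c : ℝ} (h : ∀ b, ∑ x, signVec b x * w x ≤ c) :
    l1 w ≤ c := by
  classical
  refine le_of_eq_of_le (sum_congr rfl fun x _ => ?_) (h fun x => decide (0 ≤ w x))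
  by_cases hx : 0 ≤ w x
  · simp [signVec, hx, abs_of_nonneg hx]
  · simp [signVec, hx, abs_of_neg (not_le.1 hx)]

lemma l1_sub_empKernel_le [Nonempty X] {h : ℕ → Fin (N + 1) → X × A} {t : ℕ} {i : Fin N}
    {y : X × A} {w : X → ℝ} {a : ℝ} (ha : 0 < a) (hv : visits h t i.castSucc y ≠ 0)
    (hdev : ∀ b, ∑ x, transitions h t i y x *
      hoeffdingLog w (signVec b) √(2 * a / visits h t i.castSucc y) x ≤ a) :
    l1 (w - empKernel h t i y) ≤ √(2 * a / visits h t i.castSucc y) := by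
  have hm : (0 : ℝ) < visits h t i.castSucc y := by exact_mod_cast Nat.pos_of_ne_zero hv
  generalize hc : √(2 * a / visits h t i.castSucc y) = c at hdev ⊢
  have hc0 : 0 < c := hc ▸ Real.sqrt_pos.2 (by positivity)
  have hac : 2 * a = visits h t i.castSucc y * c ^ 2 := by
    rw [← hc, Real.sq_sqrt (by positivity), mul_div_cancel₀ _ hm.ne']
  have htrans (x : X) :
      (transitions h t i y x : ℝ) = visits h t i.castSucc y * empKernel h t i y x := by
    rw [empKernel_of_visits_ne_zero hv, mul_div_cancel₀ _ hm.ne']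
  rw [l1_sub_comm]
  refine l1_le_of_forall_signVec fun b => ?_
  have hb := hdev b
  simp only [htrans, mul_assoc, ← mul_sum, sum_mul_hoeffdingLog (isKernel_empKernel h t i y).2]
    at hb
  refine le_of_mul_le_mul_left ?_ (mul_pos hm hc0)
  simp only [Pi.sub_apply]
  linarith

variable [Fintype A] {Ω : Type*} [mΩ : MeasurableSpace Ω] {P : Measure Ω} [IsProbabilityMeasure P]
  {ℱ : Filtration ℕ mΩ} {p : Fin N → X × A → X → ℝ} {ρ : X × A → ℝ}
  {traj : ℕ → Ω → Fin (N + 1) → X × A} {pol : ℕ → Ω → Fin N → X → A → ℝ}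

lemma measureReal_le_sum_transitions_le (hp : IsKernel p) (hρ : ρ ∈ stdSimplex ℝ (X × A))
    (hobs : IsObservation P ℱ T p ρ traj pol) (i : Fin N) (y : X × A) {f : X → ℝ}
    (hf : ∑ x, p i y x * Real.exp (f x) ≤ 1) {t : ℕ} (ht : t ≤ T) (a : ℝ) :
    P.real {ω | a ≤ ∑ x, transitions (traj · ω) t i y x * f x} ≤ Real.exp (-a) := by
  classical
  let w (y' : X × A) (x : X) : ℝ := Real.exp (if y' = y then f x else 0)
  let W (τ : Fin (N + 1) → X × A) : ℝ := w (τ i.castSucc) (τ i.succ).1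
  have hW : IsSubunitWeight ℱ T (fun t ω => pathProb p (pol t ω) (initDist p ρ (pol · ω) t))
      (fun _ _ => W) (∑ τ, W τ) := by
    refine ⟨fun _ _ _ => measurable_const, fun _ _ _ _ => (Real.exp_pos _).le,
      fun _ _ _ τ => single_le_sum (f := W) (fun _ _ => (Real.exp_pos _).le) (mem_univ τ),
      fun t ht ω => ?_⟩
    have hocc := occ_mem_stdSimplex hp (hobs.isPolicy t ht ω)
      (hobs.initDist_mem_stdSimplex hp hρ ht.le ω) i.castSucc
    simp only [mul_comm (W _)]
    rw [sum_pathProb_transition hp (hobs.isPolicy t ht ω) _ i w, ← hocc.2]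
    refine sum_le_sum fun y' _ => mul_le_of_le_one_right (hocc.1 y') ?_
    by_cases hy : y' = y
    · simpa only [w, hy, if_true] using hf
    · simp only [w, hy, if_false, Real.exp_zero, mul_one, (hp i y').2, le_refl]
  have hmarkov := hW.measureReal_exp_le_prod_le hobs.hasCondLaws ht a
  simpa only [W, w, ← Real.exp_sum, Real.exp_le_exp,
    sum_ite_eq_sum_transitions (traj · _)] using hmarkov

end KernelConcentration

section LogFactor

variable (X A : Type*) [Fintype X] [Fintype A] (N T : ℕ) (δ : ℝ)

/-- The logarithm `log (|X| |A| N T / δ)` of the bonus constant and of the regret bound. -/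
noncomputable def logFactor : ℝ :=
  Real.log ((Fintype.card X : ℝ) * (Fintype.card A : ℝ) * (N : ℝ) * (T : ℝ) / δ)

variable {X A N T δ}

lemma bonusConst_eq_sqrt :
    bonusConst X A N T δ = √(2 * (Fintype.card X * logFactor X A N T δ)) := by
  rw [bonusConst, logFactor, mul_assoc]

lemma log_div_le_logFactor {c : ℝ} (hc : 0 < c) (hcard : c ≤ Fintype.card X * Fintype.card A)
    (hN : 1 ≤ N) (hT : 1 ≤ T) (hδ : 0 < δ) : Real.log (c / δ) ≤ logFactor X A N T δ := by
  have hNT : (1 : ℝ) ≤ N * T := by exact_mod_cast one_le_mul hN hT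
  refine Real.log_le_log (div_pos hc hδ) (div_le_div_of_nonneg_right ?_ hδ.le)
  rw [mul_assoc (_ * _)]
  exact hcard.trans (le_mul_of_one_le_right (hc.le.trans hcard) hNT)

lemma log_le_logFactor {c : ℝ} (hc : 0 < c) (hcard : c ≤ Fintype.card X * Fintype.card A)
    (hN : 1 ≤ N) (hT : 1 ≤ T) (hδ0 : 0 < δ) (hδ1 : δ < 1) : Real.log c ≤ logFactor X A N T δ :=
  (Real.log_le_log hc (le_div_self hc.le hδ0 hδ1.le)).trans
    (log_div_le_logFactor hc hcard hN hT hδ0)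

lemma log_one_div_le_logFactor [Nonempty X] [Nonempty A] (hN : 1 ≤ N) (hT : 1 ≤ T) (hδ : 0 < δ) :
    Real.log (1 / δ) ≤ logFactor X A N T δ :=
  log_div_le_logFactor one_pos (by exact_mod_cast one_le_mul Fintype.card_pos Fintype.card_pos)
    hN hT hδ

lemma half_le_logFactor [Nonempty X] [Nontrivial A] (hN : 1 ≤ N) (hT : 1 ≤ T) (hδ0 : 0 < δ)
    (hδ1 : δ < 1) : 1 / 2 ≤ logFactor X A N T δ := by
  have hcard : 1 * 2 ≤ Fintype.card X * Fintype.card A :=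
    Nat.mul_le_mul Fintype.card_pos Fintype.one_lt_card
  have hlog := log_le_logFactor two_pos (by exact_mod_cast hcard) hN hT hδ0 hδ1
  linarith [Real.log_two_gt_d9]

lemma one_le_logFactor [Nontrivial X] [Nontrivial A] (hN : 1 ≤ N) (hT : 1 ≤ T) (hδ0 : 0 < δ)
    (hδ1 : δ < 1) : 1 ≤ logFactor X A N T δ := by
  have hcard : 2 * 2 ≤ Fintype.card X * Fintype.card A :=
    Nat.mul_le_mul Fintype.one_lt_card Fintype.one_lt_card
  have hlog := log_le_logFactor (c := 2 * 2) (by norm_num) (by exact_mod_cast hcard) hN hT hδ0 hδ1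
  rw [Real.log_mul two_ne_zero two_ne_zero] at hlog
  linarith [Real.log_two_gt_d9]

lemma one_le_bonusConst [Nonempty X] [Nontrivial A] (hN : 1 ≤ N) (hT : 1 ≤ T) (hδ0 : 0 < δ)
    (hδ1 : δ < 1) : 1 ≤ bonusConst X A N T δ := by
  have hX : (1 : ℝ) ≤ Fintype.card X := by exact_mod_cast Fintype.card_pos
  rw [bonusConst_eq_sqrt, Real.one_le_sqrt]
  nlinarith [half_le_logFactor (X := X) (A := A) hN hT hδ0 hδ1]

lemma card_mul_exp_neg_mul_log_le {s : ℕ} {a n t : ℝ} (hs : 2 ≤ s) (ha : 1 ≤ a) (hn : 1 ≤ n)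
    (ht : 1 ≤ t) (hδ0 : 0 < δ) (hδ1 : δ < 1) :
    n * (s * a * (2 ^ s * (t * t))) * Real.exp (-(s * Real.log (s * a * n * t / δ))) ≤ 2 * δ := by
  obtain ⟨k, rfl⟩ := Nat.exists_eq_add_of_le' hs
  set M : ℝ := (k + 2 : ℕ) * a * n * t with hM
  have hM0 : 0 < M := by positivity
  have htM : 2 * t ≤ M := by
    have hk : (2 : ℝ) ≤ (k + 2 : ℕ) := by exact_mod_cast hs
    rw [hM, mul_assoc (_ : ℝ) a n]
    have h2 : 2 * 1 ≤ ((k + 2 : ℕ) : ℝ) * (a * n) :=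
      mul_le_mul hk (one_le_mul_of_one_le_of_one_le ha hn) zero_le_one (by positivity)
    exact mul_le_mul_of_nonneg_right (by linarith) (by linarith)
  have hexp : Real.exp (-((k + 2 : ℕ) * Real.log (M / δ))) = (δ / M) ^ (k + 2) := by
    rw [← mul_neg, ← Real.log_inv, inv_div, Real.exp_nat_mul, Real.exp_log (by positivity)]
  have ht2 : t * (δ / M) ≤ 1 / 2 := by
    rw [mul_div_assoc', div_le_div_iff₀ hM0 two_pos]
    nlinarith
  have hδM : 2 * (δ / M) ≤ 1 := by nlinarith [div_pos hδ0 hM0]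
  calc n * ((k + 2 : ℕ) * a * (2 ^ (k + 2) * (t * t))) *
        Real.exp (-((k + 2 : ℕ) * Real.log (M / δ)))
      = M * (δ / M) * (4 * (t * (δ / M))) * (2 * (δ / M)) ^ k := by rw [hexp, hM]; ring
    _ = δ * (4 * (t * (δ / M))) * (2 * (δ / M)) ^ k := by rw [mul_div_cancel₀ _ hM0.ne']
    _ ≤ δ * (4 * (1 / 2)) * 1 := by
        gcongr
        exact pow_le_one₀ (by positivity) hδM
    _ = 2 * δ := by ring

end LogFactor

section GoodEvent

variable {X A : Type*} [Fintype X] [Fintype A] {N T : ℕ} {δ : ℝ} {p : Fin N → X × A → X → ℝ}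
  {h : ℕ → Fin (N + 1) → X × A}

lemma bonus_eq_mul_invSqrtVisits (t : ℕ) (n : Fin (N + 1)) (y : X × A) :
    bonus T δ h t n y = bonusConst X A N T δ * invSqrtVisits h t n y := by
  rw [bonus, invSqrtVisits, mul_one_div]

lemma bonus_nonneg (t : ℕ) (n : Fin (N + 1)) (y : X × A) : 0 ≤ bonus T δ h t n y :=
  div_nonneg (Real.sqrt_nonneg _) (Real.sqrt_nonneg _)

/-- The empirical kernels of all episodes are within the bonuses of the kernel `p`. -/
def KernelsWithinBonus (T : ℕ) (δ : ℝ) (p : Fin N → X × A → X → ℝ)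
    (h : ℕ → Fin (N + 1) → X × A) : Prop :=
  ∀ t < T, ∀ i y, l1 (p i y - empKernel h t i y) ≤ bonus T δ h t i.castSucc y

lemma kernelsWithinBonus_of_subsingleton [Subsingleton X] [Nonempty X] (hp : IsKernel p) :
    KernelsWithinBonus T δ p h := by
  intro t _ i y
  rw [eq_of_mem_stdSimplex_of_subsingleton (hp i y) (isKernel_empKernel h t i y), l1_sub_self]
  exact bonus_nonneg t _ y

-- The number of visits is random, so the deviations are controlled for each of its possible values.
lemma kernelsWithinBonus_of_forall_le [Nonempty X] (hp : IsKernel p) {a : ℝ} (ha : 2 ≤ a)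
    (hC : bonusConst X A N T δ = √(2 * a))
    (hdev : ∀ i y b, ∀ t m : Fin T, ∑ x, transitions h t i y x *
      hoeffdingLog (p i y) (signVec b) √(2 * a / (m : ℕ)) x ≤ a) :
    KernelsWithinBonus T δ p h := by
  intro t ht i y
  by_cases hv : visits h t i.castSucc y = 0
  · refine (l1_sub_le_two (hp i y) (isKernel_empKernel h t i y)).trans ?_
    simp only [bonus, hv, hC, Nat.cast_zero, max_eq_left (zero_le_one' ℝ), Real.sqrt_one, div_one]
    exact Real.le_sqrt_of_sq_le (by linarith)
  · have hv1 : (1 : ℝ) ≤ visits h t i.castSucc y := by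
      exact_mod_cast Nat.one_le_iff_ne_zero.2 hv
    rw [bonus, max_eq_right hv1, hC, ← Real.sqrt_div (by linarith)]
    exact l1_sub_empKernel_le (by linarith) hv fun b =>
      hdev i y b ⟨t, ht⟩ ⟨_, (visits_le h t i.castSucc y).trans_lt ht⟩

variable {Ω : Type*} [mΩ : MeasurableSpace Ω] {P : Measure Ω} [IsProbabilityMeasure P]
  {ℱ : Filtration ℕ mΩ} {ρ : X × A → ℝ} {traj : ℕ → Ω → Fin (N + 1) → X × A}
  {pol : ℕ → Ω → Fin N → X → A → ℝ}

lemma measureReal_not_kernelsWithinBonus_le [Nonempty X] [Nontrivial A] (hp : IsKernel p)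
    (hρ : ρ ∈ stdSimplex ℝ (X × A)) (hobs : IsObservation P ℱ T p ρ traj pol) (hN : 1 ≤ N)
    (hT : 1 ≤ T) (hδ0 : 0 < δ) (hδ1 : δ < 1) :
    P.real {ω | ¬ KernelsWithinBonus T δ p (traj · ω)} ≤ 2 * δ := by
  classical
  rcases subsingleton_or_nontrivial X with _ | _
  · simpa [kernelsWithinBonus_of_subsingleton hp] using hδ0.le
  set a := Fintype.card X * logFactor X A N T δ
  let dev (j : Fin N × (X × A) × (X → Bool) × Fin T × Fin T) (x : X) : ℝ :=
    hoeffdingLog (p j.1 j.2.1) (signVec j.2.2.1) √(2 * a / (j.2.2.2.2 : ℕ)) x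
  let E (j : Fin N × (X × A) × (X → Bool) × Fin T × Fin T) : Set Ω :=
    {ω | a ≤ ∑ x, transitions (traj · ω) j.2.2.2.1 j.1 j.2.1 x * dev j x}
  have hX : (2 : ℝ) ≤ Fintype.card X := by exact_mod_cast Fintype.one_lt_card
  have ha2 : 2 ≤ a := by nlinarith [one_le_logFactor (X := X) (A := A) hN hT hδ0 hδ1]
  have hsub : {ω | ¬ KernelsWithinBonus T δ p (traj · ω)} ⊆ ⋃ j, E j := fun ω hω => by
    by_contra hE
    simp only [Set.mem_iUnion, E, Set.mem_ofPred_eq, not_exists, not_le] at hE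
    exact hω (kernelsWithinBonus_of_forall_le hp ha2 bonusConst_eq_sqrt
      fun i y b t m => (hE (i, y, b, t, m)).le)
  have hE (j) : P.real (E j) ≤ Real.exp (-a) :=
    measureReal_le_sum_transitions_le hp hρ hobs j.1 j.2.1
      (sum_mul_exp_hoeffdingLog_le_one (hp _ _) (signVec_mem_Icc _) _) j.2.2.2.1.2.le a
  calc P.real {ω | ¬ KernelsWithinBonus T δ p (traj · ω)} ≤ ∑ j, P.real (E j) :=
        (measureReal_mono hsub).trans (measureReal_iUnion_fintype_le E)
    _ ≤ ∑ _j, Real.exp (-a) := sum_le_sum fun j _ => hE j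
    _ = N * (Fintype.card X * Fintype.card A * (2 ^ Fintype.card X * (T * T))) *
          Real.exp (-a) := by simp
    _ ≤ 2 * δ := card_mul_exp_neg_mul_log_le Fintype.one_lt_card
        (by exact_mod_cast Fintype.card_pos) (by exact_mod_cast hN) (by exact_mod_cast hT) hδ0 hδ1

/-- The expected sum of `invSqrtVisits` along the trajectory of an episode: up to the bonus
constant, the bonus in the constraint of the true model. -/
noncomputable def expInvSqrtVisits (p : Fin N → X × A → X → ℝ) (h : ℕ → Fin (N + 1) → X × A)
    (t : ℕ) (π : Fin N → X → A → ℝ) (ν : X × A → ℝ) : ℝ :=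
  ∑ i : Fin N, ∑ y, occ p π ν i.castSucc y * invSqrtVisits h t i.castSucc y

/-- The expected bonuses of all episodes have a sum of order `√T`. -/
def ExpBonusesBounded (T : ℕ) (δ : ℝ) (p : Fin N → X × A → X → ℝ) (ρ : X × A → ℝ)
    (h : ℕ → Fin (N + 1) → X × A) (pol : ℕ → Fin N → X → A → ℝ) : Prop :=
  ∑ t ∈ range T, expInvSqrtVisits p h t (pol t) (initDist p ρ pol t) ≤
    2 * N * (3 * √(Fintype.card X * Fintype.card A * T) + Real.log (1 / δ))

lemma sum_pathProb_mul_sum_invSqrtVisits (hp : IsKernel p) {π : Fin N → X → A → ℝ}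
    (hπ : IsPolicy π) (ν : X × A → ℝ) (h : ℕ → Fin (N + 1) → X × A) (t : ℕ) :
    ∑ τ, pathProb p π ν τ * ∑ i : Fin N, invSqrtVisits h t i.castSucc (τ i.castSucc) =
      expInvSqrtVisits p h t π ν := by
  simp only [mul_sum]
  rw [sum_comm]
  refine sum_congr rfl fun i _ => ?_
  rw [sum_pathProb_transition hp hπ ν i fun y _ => invSqrtVisits h t i.castSucc y]
  simp only [← sum_mul, (hp i _).2, one_mul]

lemma measureReal_not_expBonusesBounded_le (hp : IsKernel p) (hρ : ρ ∈ stdSimplex ℝ (X × A))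
    (hobs : IsObservation P ℱ T p ρ traj pol) (hN : 1 ≤ N) (hδ : 0 < δ) :
    P.real {ω | ¬ ExpBonusesBounded T δ p ρ (traj · ω) (pol · ω)} ≤ δ := by
  let φ (t : ℕ) (ω : Ω) (τ : Fin (N + 1) → X × A) : ℝ :=
    ∑ i : Fin N, invSqrtVisits (traj · ω) t i.castSucc (τ i.castSucc)
  have hφ (t : ℕ) (ω : Ω) (τ) : φ t ω τ ∈ Set.Icc 0 (N : ℝ) :=
    ⟨sum_nonneg fun i _ => invSqrtVisits_nonneg _ _ _ _,
      (sum_le_sum fun i _ => invSqrtVisits_le_one _ _ _ _).trans (by simp)⟩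
  have hφsum (ω : Ω) :
      ∑ t ∈ range T, φ t ω (traj t ω) ≤ N * (3 * √(Fintype.card X * Fintype.card A * T)) := by
    simp only [φ]
    rw [sum_comm]
    exact (sum_le_sum fun i _ => sum_invSqrtVisits_le (traj · ω) T i.castSucc).trans (by simp)
  have hconc := measureReal_sum_condMean_ge_le (b := N) (φ := φ) (by exact_mod_cast hN)
    hobs.hasCondLaws (fun t ht ω => hobs.pathProb_mem_stdSimplex hp hρ ht ω)
    (fun t ht τ => hobs.measurable_pathProb ht τ)
    (fun t ht τ => Finset.measurable_sum _ fun i _ => hobs.measurable_invSqrtVisits ht.le _ _)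
    hφ (Real.log (1 / δ))
  rw [← Real.log_inv, one_div, inv_inv, Real.exp_log hδ] at hconc
  refine (measureReal_mono fun ω hω => ?_).trans hconc
  have hmean : ∑ t ∈ range T, ∑ τ, pathProb p (pol t ω) (initDist p ρ (pol · ω) t) τ * φ t ω τ =
      ∑ t ∈ range T, expInvSqrtVisits p (traj · ω) t (pol t ω) (initDist p ρ (pol · ω) t) :=
    sum_congr rfl fun t ht => sum_pathProb_mul_sum_invSqrtVisits hp
      (hobs.isPolicy t (mem_range.1 ht) ω) _ _ t
  simp only [ExpBonusesBounded, one_div, Set.mem_ofPred_eq, not_le] at hω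
  rw [Set.mem_ofPred_eq, hmean]
  linarith [hφsum ω]

lemma exists_goodEvent [Nonempty X] [Nontrivial A] (hp : IsKernel p)
    (hρ : ρ ∈ stdSimplex ℝ (X × A)) (hobs : IsObservation P ℱ T p ρ traj pol) (hN : 1 ≤ N)
    (hT : 1 ≤ T) (hδ0 : 0 < δ) (hδ1 : δ < 1) :
    ∃ E : Set Ω, MeasurableSet E ∧ ENNReal.ofReal (1 - 3 * δ) ≤ P E ∧ ∀ ω ∈ E,
      KernelsWithinBonus T δ p (traj · ω) ∧
        ExpBonusesBounded T δ p ρ (traj · ω) (pol · ω) := by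
  set B := {ω | ¬ KernelsWithinBonus T δ p (traj · ω)} ∪
    {ω | ¬ ExpBonusesBounded T δ p ρ (traj · ω) (pol · ω)}
  have hB : P.real (toMeasurable P B) ≤ 3 * δ := by
    rw [measureReal_def, measure_toMeasurable, ← measureReal_def]
    linarith [measureReal_union_le (μ := P) {ω | ¬ KernelsWithinBonus T δ p (traj · ω)}
      {ω | ¬ ExpBonusesBounded T δ p ρ (traj · ω) (pol · ω)},
      measureReal_not_kernelsWithinBonus_le hp hρ hobs hN hT hδ0 hδ1,
      measureReal_not_expBonusesBounded_le hp hρ hobs hN hδ0]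
  have hmeas := measurableSet_toMeasurable P B
  refine ⟨(toMeasurable P B)ᶜ, hmeas.compl, ?_, fun ω hω => ?_⟩
  · rw [← ofReal_measureReal, probReal_compl_eq_one_sub hmeas]
    exact ENNReal.ofReal_le_ofReal (by linarith)
  · have hωB : ω ∉ B := fun h => hω (subset_toMeasurable P B h)
    simpa only [B, Set.mem_union, Set.mem_ofPred_eq, not_or, not_not] using hωB

end GoodEvent

section Gradients

lemma exists_le_of_mem_stdSimplex {S : Type*} [Fintype S] [Nonempty S] {w : S → ℝ}
    (hw : w ∈ stdSimplex ℝ S) : ∃ y, w y ≤ 1 / Fintype.card S := by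
  have hsum : ∑ y, w y ≤ ∑ _y : S, 1 / (Fintype.card S : ℝ) := by simp [hw.2]
  simpa using exists_le_of_sum_le univ_nonempty hsum

lemma exists_half_le_or_le_third_of_mem_stdSimplex {S : Type*} [Fintype S] [Nontrivial S]
    {w : S → ℝ} (hw : w ∈ stdSimplex ℝ S) : ∃ y, 1 / 2 ≤ w y ∨ w y ≤ 1 / 3 := by
  rcases (Nat.succ_le_of_lt (Fintype.one_lt_card (α := S))).eq_or_lt with hcard | hcard
  · have hsum : ∑ _y : S, (1 / 2 : ℝ) ≤ ∑ y, w y := by simp [hw.2, ← hcard]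
    obtain ⟨y, -, hy⟩ := exists_le_of_sum_le univ_nonempty hsum
    exact ⟨y, Or.inl hy⟩
  · obtain ⟨y, hy⟩ := exists_le_of_mem_stdSimplex hw
    have hthree : (3 : ℝ) ≤ Fintype.card S := by exact_mod_cast hcard
    exact ⟨y, Or.inr (hy.trans (one_div_le_one_div_of_le three_pos hthree))⟩

-- Since `1 / 3 < exp (-1) < 1 / 2`, no probability vector has all its entries close to `exp (-1)`.
lemma exists_le_abs_log_add_one {S : Type*} [Fintype S] [Nontrivial S] {w : S → ℝ}
    (hw : w ∈ stdSimplex ℝ S) (hpos : ∀ y, 0 < w y) : ∃ y, 1 / 16 ≤ |Real.log (w y) + 1| := by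
  obtain ⟨y, hy | hy⟩ := exists_half_le_or_le_third_of_mem_stdSimplex hw
  · have hlog := Real.log_le_log (by norm_num) hy
    rw [one_div, Real.log_inv] at hlog
    exact ⟨y, le_abs.2 (Or.inl (by linarith [Real.log_two_lt_d9]))⟩
  · have hlog := Real.log_le_log (hpos y) hy
    rw [one_div, Real.log_inv] at hlog
    exact ⟨y, le_abs.2 (Or.inr (by linarith [Real.log_three_gt_d9]))⟩

lemma exists_le_abs_log {S : Type*} [Fintype S] [Nontrivial S] {w : S → ℝ}
    (hw : w ∈ stdSimplex ℝ S) (hpos : ∀ y, 0 < w y) : ∃ y, 1 / 16 ≤ |Real.log (w y)| := by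
  obtain ⟨y, hy⟩ := exists_le_of_mem_stdSimplex hw
  have hcard : (2 : ℝ) ≤ Fintype.card S := by exact_mod_cast Fintype.one_lt_card (α := S)
  have hlog := Real.log_le_log (hpos y) (hy.trans (one_div_le_one_div_of_le two_pos hcard))
  rw [one_div, Real.log_inv] at hlog
  exact ⟨y, le_abs.2 (Or.inr (by linarith [Real.log_two_gt_d9]))⟩

variable {X A : Type*} [Fintype X] [Fintype A] {N : ℕ} {p p' : Fin N → X × A → X → ℝ}
  {π π' : Fin N → X → A → ℝ} {ν ν' : X × A → ℝ}

lemma le_norm1inf_grad [Nonempty X] [Nontrivial A] {D : Div} (hp : IsKernel p) (hπ : IsPolicy π)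
    (hν : ν ∈ stdSimplex ℝ (X × A)) (hN : 1 ≤ N) (hreg : D.Regular (occ p π ν) π) :
    1 / 16 ≤ norm1inf (D.grad (occ p π ν) π) := by
  let i : Fin N := ⟨0, hN⟩
  suffices hentry : ∃ y, 1 / 16 ≤ |D.grad (occ p π ν) π i y| from
    hentry.elim fun y hy => hy.trans (abs_le_norm1inf _ i y)
  cases D with
  | kl => exact exists_le_abs_log_add_one (occ_mem_stdSimplex hp hπ hν i.succ) (hreg i)
  | gamma =>
    inhabit X
    obtain ⟨a, ha⟩ := exists_le_abs_log (hπ i default) (hreg i default)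
    exact ⟨(default, a), ha⟩

lemma l1_sub_le_two_mul_sqrt_of_relEnt_le {S : Type*} [Fintype S] {a b : S → ℝ} {K : ℝ}
    (ha : a ∈ stdSimplex ℝ S) (hb : b ∈ stdSimplex ℝ S) (hab : ∀ y, b y = 0 → a y = 0)
    (hK : relEnt a b ≤ K) : l1 (a - b) ≤ 2 * √K := by
  have hsq : l1 (a - b) ^ 2 ≤ 2 ^ 2 * K := by linarith [sq_l1_sub_le_relEnt ha hb hab]
  simpa using Real.le_sqrt_of_sq_le hsq

lemma pairing_grad_kl_sub (μ μ' : Fin (N + 1) → X × A → ℝ) :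
    pairing (Div.kl.grad μ' π' - Div.kl.grad μ π) μ' =
      ∑ i : Fin N, relEnt (μ' i.succ) (μ i.succ) := by
  simp only [pairing, relEnt, Div.grad, Pi.sub_apply, add_sub_add_right_eq_sub, mul_comm]

-- For `gamma` the relative entropy only compares two policies in the same model, hence the passage
-- through `occ p' π ν'`.
lemma l1_occ_sub_le_two_mul_sqrt_pairing_grad {D : Div} {d : ℝ} (hp : IsKernel p)
    (hp' : IsKernel p') (hπ : IsPolicy π) (hπ' : IsPolicy π') (hν : ν ∈ stdSimplex ℝ (X × A))
    (hν' : ν' ∈ stdSimplex ℝ (X × A)) (hreg : D.Regular (occ p π ν) π)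
    (hreg' : D.Regular (occ p' π' ν') π') (hd0 : 0 ≤ d)
    (hd : ∀ n, l1 (occ p' π ν' n - occ p π ν n) ≤ d) :
    0 ≤ pairing (D.grad (occ p' π' ν') π' - D.grad (occ p π ν) π) (occ p' π' ν') ∧
      ∀ i : Fin N, l1 (occ p' π' ν' i.succ - occ p π ν i.succ) ≤
        2 * √(pairing (D.grad (occ p' π' ν') π' - D.grad (occ p π ν) π) (occ p' π' ν')) + d := by
  have hocc := occ_mem_stdSimplex hp hπ hν
  have hocc' := occ_mem_stdSimplex hp' hπ' hν'
  cases D with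
  | kl =>
    have hac (i : Fin N) (y : X × A) (hy : occ p π ν i.succ y = 0) : occ p' π' ν' i.succ y = 0 :=
      absurd hy (hreg i y).ne'
    have hnonneg (i : Fin N) (_ : i ∈ univ) := relEnt_nonneg (hocc' i.succ) (hocc i.succ) (hac i)
    rw [pairing_grad_kl_sub]
    refine ⟨sum_nonneg hnonneg, fun i => le_add_of_le_of_nonneg ?_ hd0⟩
    exact l1_sub_le_two_mul_sqrt_of_relEnt_le (hocc' i.succ) (hocc i.succ) (hac i)
      (single_le_sum hnonneg (mem_univ i))
  | gamma =>
    have hac (i : Fin N) (x : X) (a : A) (h : π i x a = 0) : π' i x a = 0 :=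
      absurd h (hreg i x a).ne'
    have hmid := occ_mem_stdSimplex hp' hπ hν'
    have hzero := occ_eq_zero_of_occ_eq_zero hp' hπ hac hν'
    have hrelEnt := relEnt_occ_le hp' hπ' hπ hac hν'
    refine ⟨(relEnt_nonneg (hocc' 0) (hmid 0) (hzero 0)).trans (hrelEnt 0), fun i => ?_⟩
    exact (l1_sub_le _ (occ p' π ν' i.succ) _).trans (add_le_add
      (l1_sub_le_two_mul_sqrt_of_relEnt_le (hocc' _) (hmid _) (hzero _) (hrelEnt _)) (hd _))

lemma mirror_descent_step {D : Div} {σ : Fin N → X → A → ℝ} {C : Set (Fin (N + 1) → X × A → ℝ)}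
    {z : Fin N → X × A → ℝ} {η d κ : ℝ} (hp : IsKernel p) (hp' : IsKernel p') (hπ : IsPolicy π)
    (hπ' : IsPolicy π') (hσ : IsPolicy σ) (hν : ν ∈ stdSimplex ℝ (X × A))
    (hν' : ν' ∈ stdSimplex ℝ (X × A)) (hreg : D.Regular (occ p π ν) π)
    (hreg' : D.Regular (occ p' π' ν') π') (hC : Convex ℝ C) (hπC : occ p' π' ν' ∈ C)
    (hσC : occ p' σ ν' ∈ C)
    (hmin : IsMinOn (fun μ => η * pairing z μ + D.val μ (occ p π ν) π) C (occ p' π' ν'))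
    (hη : 0 ≤ η) (hz : norm1inf z ≤ κ) (hd0 : 0 ≤ d)
    (hd : ∀ τ, IsPolicy τ → ∀ n, l1 (occ p' τ ν' n - occ p τ ν n) ≤ d) :
    η * pairing z (occ p π ν - occ p σ ν) ≤
      pairing (D.grad (occ p' π' ν') π' - D.grad (occ p π ν) π) (occ p' σ ν') +
        (η * κ) ^ 2 + 2 * (η * κ) * d := by
  have hfirst := occ_first_order hp' hπ' hσ hν' hC hπC hσC hmin hreg' hreg
  obtain ⟨hK, hmove⟩ :=
    l1_occ_sub_le_two_mul_sqrt_pairing_grad hp hp' hπ hπ' hν hν' hreg hreg' hd0 (hd π hπ)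
  set G := D.grad (occ p' π' ν') π' - D.grad (occ p π ν) π
  set K := pairing G (occ p' π' ν')
  have hpair {μ μ' : Fin (N + 1) → X × A → ℝ} {c : ℝ} (hc : 0 ≤ c)
      (h : ∀ i : Fin N, l1 (μ i.succ - μ' i.succ) ≤ c) :
      η * (pairing z μ - pairing z μ') ≤ η * κ * c := by
    rw [mul_assoc, ← pairing_sub]
    exact mul_le_mul_of_nonneg_left ((le_abs_self _).trans <|
      (abs_pairing_le z h).trans (mul_le_mul_of_nonneg_right hz hc)) hη
  have hplayed := hpair (by positivity) fun i => (l1_sub_comm _ _).trans_le (hmove i)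
  have hcompared := hpair hd0 fun i => hd σ hσ i.succ
  rw [pairing_sub, pairing_sub] at hfirst
  rw [pairing_sub]
  have hamgm : 2 * (η * κ) * √K ≤ (η * κ) ^ 2 + K := by
    linarith [two_mul_le_add_sq (η * κ) √K, Real.sq_sqrt hK]
  linarith

end Gradients

section Summation

lemma sum_le_of_le_mul_add {r m : ℕ → ℝ} {α : ℝ} {n : ℕ} (hα : 0 ≤ α) (hr : 0 ≤ r n)
    (h : ∀ t < n, r (t + 1) ≤ α * r t + m t) :
    (1 - α) * ∑ t ∈ range (n + 1), r t ≤ r 0 + ∑ t ∈ range n, m t := by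
  have hsum := sum_le_sum fun t ht => h t (mem_range.1 ht)
  rw [sum_add_distrib, ← mul_sum] at hsum
  have hlast := mul_nonneg hα hr
  rw [one_sub_mul]
  nth_rw 1 [sum_range_succ']
  rw [sum_range_succ, mul_add]
  linarith

variable {X A : Type*} [Fintype X] [Fintype A] {N : ℕ}

lemma sum_pairing_sub_succ (G : ℕ → Fin N → X × A → ℝ) (c : ℕ → Fin (N + 1) → X × A → ℝ) (n : ℕ) :
    ∑ t ∈ range n, pairing (G (t + 1) - G t) (c (t + 1)) =
      pairing (G n) (c n) - pairing (G 0) (c 0) -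
        ∑ t ∈ range n, pairing (G t) (c (t + 1) - c t) := by
  rw [← sum_range_sub (fun t => pairing (G t) (c t)), ← sum_sub_distrib]
  simp only [pairing_sub, pairing_sub_left]
  exact sum_congr rfl fun t _ => by ring

lemma sum_pairing_sub_succ_le {G : ℕ → Fin N → X × A → ℝ} {c : ℕ → Fin (N + 1) → X × A → ℝ}
    {d : ℕ → ℝ} {Ψ : ℝ} {n : ℕ} (hG : ∀ t ≤ n, norm1inf (G t) ≤ Ψ)
    (hc : ∀ t ≤ n, ∀ i : Fin N, l1 (c t i.succ) ≤ 1)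
    (hd : ∀ t < n, 0 ≤ d t ∧ ∀ i : Fin N, l1 (c (t + 1) i.succ - c t i.succ) ≤ d t) :
    ∑ t ∈ range n, pairing (G (t + 1) - G t) (c (t + 1)) ≤ Ψ * (∑ t ∈ range n, d t + 2) := by
  have hvalue (t : ℕ) (ht : t ≤ n) : |pairing (G t) (c t)| ≤ Ψ :=
    (abs_pairing_le (G t) (hc t ht)).trans (by simpa using hG t ht)
  have hchange : ∑ t ∈ range n, -pairing (G t) (c (t + 1) - c t) ≤ Ψ * ∑ t ∈ range n, d t := by
    rw [mul_sum]
    refine sum_le_sum fun t ht => (neg_le_abs _).trans ?_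
    obtain ⟨hd0, hdt⟩ := hd t (mem_range.1 ht)
    exact (abs_pairing_le (G t) hdt).trans
      (mul_le_mul_of_nonneg_right (hG t (mem_range.1 ht).le) hd0)
  rw [sum_pairing_sub_succ]
  rw [sum_neg_distrib] at hchange
  linarith [(abs_le.1 (hvalue n le_rfl)).2, (abs_le.1 (hvalue 0 n.zero_le)).1]

end Summation

section LossVectors

variable {X A : Type*} [Fintype X] [Fintype A] {N T : ℕ} {δ ℓ : ℝ}

lemma IsSubgradient.abs_le {f : (X × A → ℝ) → ℝ} {u v : X × A → ℝ} (hv : IsSubgradient f u v)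
    (hf : ∀ w w', |f w - f w'| ≤ ℓ * l1 (w - w')) (y : X × A) : |v y| ≤ ℓ := by
  classical
  have hdir (c : ℝ) : v y * c ≤ ℓ * |c| := by
    have hsub := hv (u + Pi.single y c)
    have hlip := (le_abs_self _).trans (hf (u + Pi.single y c) u)
    simp only [Pi.add_apply, add_sub_cancel_left, Pi.single_apply, mul_ite, mul_zero,
      sum_ite_eq', mem_univ, if_true] at hsub
    simp only [l1, add_sub_cancel_left, Pi.single_apply, apply_ite abs, abs_zero, sum_ite_eq',
      mem_univ, if_true] at hlip
    linarith
  have hpos := hdir 1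
  have hneg := hdir (-1)
  simp only [abs_neg, abs_one] at hpos hneg
  exact _root_.abs_le.2 ⟨by linarith, by linarith⟩

lemma abs_lossBonus_succ_le (hℓ : 0 ≤ ℓ) (h : ℕ → Fin (N + 1) → X × A) (t : ℕ) (i : Fin N)
    (y : X × A) : |lossBonus T δ ℓ h t i.succ y| ≤ ℓ * (N - 1) * bonusConst X A N T δ := by
  have hC : 0 ≤ bonusConst X A N T δ := Real.sqrt_nonneg _
  have hi : ((i.succ : ℕ) : ℝ) ≤ N := by exact_mod_cast i.succ.is_le
  have hi1 : (1 : ℝ) ≤ (i.succ : ℕ) := by exact_mod_cast Nat.le_add_left 1 i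
  have hnum : 0 ≤ ℓ * ((N : ℝ) - (i.succ : ℕ)) * bonusConst X A N T δ :=
    mul_nonneg (mul_nonneg hℓ (sub_nonneg.2 hi)) hC
  rw [lossBonus, abs_of_nonneg (div_nonneg hnum (Real.sqrt_nonneg _))]
  refine (div_le_self hnum (Real.one_le_sqrt.2 (le_max_left _ _))).trans ?_
  gcongr

variable (X A N T δ ℓ) in
/-- A bound on the `(1, ∞)` norm of the vectors `mdVec` fed to mirror descent. -/
noncomputable def mdVecBound : ℝ := N * (ℓ * (N * bonusConst X A N T δ))

lemma mdVecBound_nonneg (hℓ : 0 ≤ ℓ) : 0 ≤ mdVecBound X A N T δ ℓ := by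
  have hC : 0 ≤ bonusConst X A N T δ := Real.sqrt_nonneg _
  unfold mdVecBound
  positivity

lemma norm1inf_mdVec_le {g : Fin N → X × A → ℝ} (hC : 1 ≤ bonusConst X A N T δ) (hℓ : 0 ≤ ℓ)
    (hg : ∀ i y, |g i y| ≤ ℓ) (h : ℕ → Fin (N + 1) → X × A) (t : ℕ) :
    norm1inf (mdVec T δ ℓ h g t) ≤ mdVecBound X A N T δ ℓ := by
  refine norm1inf_le (by positivity) fun i y => ?_
  calc |mdVec T δ ℓ h g t i y| ≤ |g i y| + |lossBonus T δ ℓ h t i.succ y| := abs_sub _ _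
    _ ≤ ℓ * bonusConst X A N T δ + ℓ * (N - 1) * bonusConst X A N T δ :=
        add_le_add ((hg i y).trans (le_mul_of_one_le_right hℓ hC))
          (abs_lossBonus_succ_le hℓ h t i y)
    _ = ℓ * (N * bonusConst X A N T δ) := by ring

end LossVectors

section Drift

variable {X A : Type*} [Fintype X] [Fintype A] {N T : ℕ} {δ ℓ α : ℝ}
  {p : Fin N → X × A → X → ℝ} {ρ ν : X × A → ℝ} {h : ℕ → Fin (N + 1) → X × A}
  {pol : ℕ → Fin N → X → A → ℝ} {π : Fin N → X → A → ℝ} {t : ℕ}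

/-- A bound, uniform in the policy, on the `L¹` distance between the distributions that a policy
induces in the estimated models of the episodes `t` and `t + 1`: the change of the initial
distribution plus the changes of the empirical kernels. -/
noncomputable def drift (p : Fin N → X × A → X → ℝ) (ρ : X × A → ℝ) (h : ℕ → Fin (N + 1) → X × A)
    (pol : ℕ → Fin N → X → A → ℝ) (t : ℕ) : ℝ :=
  l1 (initDist p ρ pol (t + 1) - initDist p ρ pol t) +
    ∑ i : Fin N, 2 * invSqrtVisits h t i.castSucc (h t i.castSucc)

lemma drift_nonneg (p : Fin N → X × A → X → ℝ) (ρ : X × A → ℝ) (h : ℕ → Fin (N + 1) → X × A)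
    (pol : ℕ → Fin N → X → A → ℝ) (t : ℕ) : 0 ≤ drift p ρ h pol t :=
  add_nonneg (l1_nonneg _) <| sum_nonneg fun _ _ =>
    mul_nonneg zero_le_two (invSqrtVisits_nonneg _ _ _ _)

lemma l1_occ_succ_sub_le_drift [Nonempty X] (hπ : IsPolicy π)
    (hν : initDist p ρ pol (t + 1) ∈ stdSimplex ℝ (X × A)) (n : Fin (N + 1)) :
    l1 (occ (empKernel h (t + 1)) π (initDist p ρ pol (t + 1)) n -
      occ (empKernel h t) π (initDist p ρ pol t) n) ≤ drift p ρ h pol t := by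
  have hp := isKernel_empKernel h (t + 1)
  refine (l1_occ_sub_le hp (isKernel_empKernel h t) hπ hν n).trans
    (add_le_add_right (sum_le_sum fun i _ => ?_) _)
  have hocc := occ_mem_stdSimplex hp hπ hν i.castSucc
  calc ∑ y, occ (empKernel h (t + 1)) π (initDist p ρ pol (t + 1)) i.castSucc y *
        l1 (empKernel h (t + 1) i y - empKernel h t i y)
      ≤ ∑ y, occ (empKernel h (t + 1)) π (initDist p ρ pol (t + 1)) i.castSucc y *
        (2 * invSqrtVisits h t i.castSucc (h t i.castSucc)) :=
        sum_le_sum fun y _ => mul_le_mul_of_nonneg_left (l1_empKernel_succ_sub_le h t i y)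
          (hocc.1 y)
    _ = 2 * invSqrtVisits h t i.castSucc (h t i.castSucc) := by rw [← sum_mul, hocc.2, one_mul]

lemma l1_occ_sub_le_bonus {q q' : Fin N → X × A → X → ℝ} (hq : IsKernel q) (hq' : IsKernel q')
    (hπ : IsPolicy π) (hν : ν ∈ stdSimplex ℝ (X × A))
    (hqq : ∀ i y, l1 (q i y - q' i y) ≤ bonus T δ h t i.castSucc y) (n : Fin (N + 1)) :
    l1 (occ q π ν n - occ q' π ν n) ≤
      ∑ i : Fin N, ∑ y, occ q π ν i.castSucc y * bonus T δ h t i.castSucc y := by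
  refine (l1_occ_sub_le hq hq' hπ hν n).trans ?_
  rw [l1_sub_self, zero_add]
  exact sum_le_sum fun i _ => sum_le_sum fun y _ =>
    mul_le_mul_of_nonneg_left (hqq i y) ((occ_mem_stdSimplex hq hπ hν _).1 y)

lemma occ_mem_constraintSet [Nonempty X] (hp : IsKernel p) (hρ : ρ ∈ stdSimplex ℝ (X × A))
    (hα : Contracts p ρ α) (hπ : IsPeriodic p ρ π) (hν : ν ∈ stdSimplex ℝ (X × A))
    (hb : ∀ i y, l1 (p i y - empKernel h t i y) ≤ bonus T δ h t i.castSucc y) :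
    occ (empKernel h t) π ν ∈ constraintSet T δ α ρ ν h t := by
  have hemp := isKernel_empKernel h t
  refine ⟨occ_mem_flowSet hemp hπ.1 hν, (l1_sub_le _ (terminal p π ν) _).trans (add_le_add ?_ ?_)⟩
  · exact l1_occ_sub_le_bonus hemp hp hπ.1 hν (fun i y => (l1_sub_comm _ _).trans_le (hb i y)) _
  · simpa only [hπ.2] using hα π hπ ν hν ρ hρ

lemma expInvSqrtVisits_nonneg (hp : IsKernel p) (hπ : IsPolicy π)
    (hν : ν ∈ stdSimplex ℝ (X × A)) : 0 ≤ expInvSqrtVisits p h t π ν :=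
  sum_nonneg fun _ _ => sum_nonneg fun y _ =>
    mul_nonneg ((occ_mem_stdSimplex hp hπ hν _).1 y) (invSqrtVisits_nonneg _ _ _ _)

lemma sum_occ_mul_bonus :
    ∑ i : Fin N, ∑ y, occ p π ν i.castSucc y * bonus T δ h t i.castSucc y =
      bonusConst X A N T δ * expInvSqrtVisits p h t π ν := by
  simp only [bonus_eq_mul_invSqrtVisits, expInvSqrtVisits, mul_sum, mul_left_comm]

lemma sum_mul_bonus_le_add {μ μ' : Fin (N + 1) → X × A → ℝ} {c : ℝ}
    (hμ : ∀ n, l1 (μ n - μ' n) ≤ c) :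
    ∑ i : Fin N, ∑ y, μ i.castSucc y * bonus T δ h t i.castSucc y ≤
      ∑ i : Fin N, ∑ y, μ' i.castSucc y * bonus T δ h t i.castSucc y +
        N * (bonusConst X A N T δ * c) := by
  have hC : 0 ≤ bonusConst X A N T δ := Real.sqrt_nonneg _
  have hbonus (n : Fin (N + 1)) (y : X × A) : |bonus T δ h t n y| ≤ bonusConst X A N T δ := by
    rw [abs_of_nonneg (bonus_nonneg t n y), bonus_eq_mul_invSqrtVisits]
    exact mul_le_of_le_one_right hC (invSqrtVisits_le_one _ _ _ _)
  have hstep (i : Fin N) :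
      ∑ y, (μ i.castSucc y - μ' i.castSucc y) * bonus T δ h t i.castSucc y ≤
        bonusConst X A N T δ * c := by
    simp only [mul_comm _ (bonus T δ h t i.castSucc _)]
    exact (le_abs_self _).trans <| (abs_sum_mul_le (hbonus i.castSucc) _).trans <|
      mul_le_mul_of_nonneg_left (hμ _) hC
  have hsum := sum_le_sum fun i (_ : i ∈ univ) => hstep i
  simp only [sub_mul, sum_sub_distrib, sum_const, card_univ, Fintype.card_fin,
    nsmul_eq_mul] at hsum
  linarith

lemma l1_terminal_sub_le [Nonempty X] (hp : IsKernel p) (hπ : IsPolicy π)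
    (hν : ν ∈ stdSimplex ℝ (X × A))
    (hb : ∀ i y, l1 (p i y - empKernel h t i y) ≤ bonus T δ h t i.castSucc y)
    (hmem : occ (empKernel h t) π ν ∈ constraintSet T δ α ρ ν h t) :
    l1 (terminal p π ν - ρ) ≤ α * l1 (ν - ρ) +
      (2 + N * bonusConst X A N T δ) * (bonusConst X A N T δ * expInvSqrtVisits p h t π ν) := by
  have hdist := l1_occ_sub_le_bonus hp (isKernel_empKernel h t) hπ hν hb
  have hbonus := sum_mul_bonus_le_add (T := T) (δ := δ) (h := h) (t := t)
    fun n => (l1_sub_comm _ _).trans_le (hdist n)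
  have htri := (l1_sub_le (terminal p π ν) (occ (empKernel h t) π ν (Fin.last N)) ρ).trans
    (add_le_add (hdist (Fin.last N)) hmem.2)
  simp only [sum_occ_mul_bonus] at hbonus htri
  linarith

lemma l1_initDist_succ_sub_le [Nonempty X] (hp : IsKernel p) (hρ : ρ ∈ stdSimplex ℝ (X × A))
    (hpol : ∀ t < T, IsPolicy (pol t)) (hα : 0 ≤ α) (hgood : KernelsWithinBonus T δ p h)
    (hmem : ∀ t, t + 1 < T → iterate p ρ h pol (t + 1) ∈
      constraintSet T δ α ρ (initDist p ρ pol (t + 1)) h (t + 1)) (ht : t < T) :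
    l1 (initDist p ρ pol (t + 1) - ρ) ≤ α * l1 (initDist p ρ pol t - ρ) +
      ((2 + N * bonusConst X A N T δ) *
        (bonusConst X A N T δ * expInvSqrtVisits p h t (pol t) (initDist p ρ pol t)) +
        if t = 0 then 2 else 0) := by
  have hC : 0 ≤ bonusConst X A N T δ := Real.sqrt_nonneg _
  have hν := initDist_mem_stdSimplex hp hρ hpol ht.le
  rcases t with _ | t
  · have hexp := expInvSqrtVisits_nonneg (h := h) (t := 0) hp (hpol 0 ht) hν
    refine (l1_sub_le_two (initDist_mem_stdSimplex hp hρ hpol ht) hρ).trans ?_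
    rw [if_pos rfl, ← add_assoc]
    exact le_add_of_nonneg_left <| add_nonneg (mul_nonneg hα (l1_nonneg _)) (by positivity)
  · rw [if_neg t.succ_ne_zero, add_zero]
    exact l1_terminal_sub_le hp (hpol _ ht) hν (hgood _ ht) (hmem t ht)

lemma sum_l1_initDist_succ_sub_le {m : ℕ → ℝ} (hα0 : 0 ≤ α) (hα1 : α < 1)
    (hm : ∀ t < T, l1 (initDist p ρ pol (t + 1) - ρ) ≤ α * l1 (initDist p ρ pol t - ρ) + m t) :
    ∑ t ∈ range T, l1 (initDist p ρ pol (t + 1) - initDist p ρ pol t) ≤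
      2 * ((∑ t ∈ range T, m t) / (1 - α)) := by
  let r (t : ℕ) : ℝ := l1 (initDist p ρ pol t - ρ)
  have hr : ∑ t ∈ range (T + 1), r t ≤ (∑ t ∈ range T, m t) / (1 - α) := by
    have hr0 : r 0 = 0 := l1_sub_self ρ
    have hsum := sum_le_of_le_mul_add (r := r) hα0 (l1_nonneg _) hm
    rwa [hr0, zero_add, ← le_div_iff₀' (sub_pos.2 hα1)] at hsum
  have htri : ∑ t ∈ range T, l1 (initDist p ρ pol (t + 1) - initDist p ρ pol t) ≤
      ∑ t ∈ range T, (r (t + 1) + r t) := sum_le_sum fun t _ =>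
    (l1_sub_le _ ρ _).trans (add_le_add_right (l1_sub_comm _ _).le _)
  have hr0 : 0 ≤ r 0 := l1_nonneg _
  have hrT : 0 ≤ r T := l1_nonneg _
  rw [sum_add_distrib] at htri
  linarith [sum_range_succ' r T, sum_range_succ r T]

lemma sum_drift_le {m : ℕ → ℝ} (hα0 : 0 ≤ α) (hα1 : α < 1)
    (hm : ∀ t < T, l1 (initDist p ρ pol (t + 1) - ρ) ≤ α * l1 (initDist p ρ pol t - ρ) + m t) :
    ∑ t ∈ range T, drift p ρ h pol t ≤ 2 * ((∑ t ∈ range T, m t) / (1 - α)) +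
      6 * (N * √((Fintype.card X : ℝ) * Fintype.card A * T)) := by
  have hkernel : ∑ t ∈ range T, ∑ i : Fin N, 2 * invSqrtVisits h t i.castSucc (h t i.castSucc) ≤
      6 * (N * √((Fintype.card X : ℝ) * Fintype.card A * T)) := by
    simp only [← mul_sum]
    rw [sum_comm]
    have hsum := sum_le_sum fun i (_ : i ∈ (univ : Finset (Fin N))) =>
      sum_invSqrtVisits_le h T i.castSucc
    simp only [sum_const, card_univ, Fintype.card_fin, nsmul_eq_mul] at hsum
    linarith
  simp only [drift, sum_add_distrib]
  exact add_le_add (sum_l1_initDist_succ_sub_le hα0 hα1 hm) hkernel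

end Drift

section Regret

variable {X A : Type*} [Fintype X] [Fintype A] {N T : ℕ} {δ ℓ α η Ψ κ : ℝ}
  {p : Fin N → X × A → X → ℝ} {ρ : X × A → ℝ} {h : ℕ → Fin (N + 1) → X × A}
  {pol : ℕ → Fin N → X → A → ℝ} {π : Fin N → X → A → ℝ} {t : ℕ} {D : Div}
  {g : ℕ → Fin N → X × A → ℝ}

lemma pairing_mdVec_le [Nonempty X] (hp : IsKernel p) (hρ : ρ ∈ stdSimplex ℝ (X × A))
    (hpol : ∀ t < T, IsPolicy (pol t)) (hπ : IsPolicy π) (ht : t < T)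
    (hz : norm1inf (mdVec T δ ℓ h (g t) t) ≤ κ) :
    pairing (mdVec T δ ℓ h (g t) t)
      (iterate p ρ h pol t - occ (empKernel h t) π (initDist p ρ pol t)) ≤ 2 * κ := by
  have hemp := isKernel_empKernel h t
  have hν := initDist_mem_stdSimplex hp hρ hpol ht.le
  refine (le_abs_self _).trans <| (abs_pairing_le _ fun i => l1_sub_le_two
    (occ_mem_stdSimplex hemp (hpol t ht) hν _) (occ_mem_stdSimplex hemp hπ hν _)).trans ?_
  rw [mul_comm]
  exact mul_le_mul_of_nonneg_left hz zero_le_two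

lemma regretMD_le_two_mul [Nonempty X] (hp : IsKernel p) (hρ : ρ ∈ stdSimplex ℝ (X × A))
    (hpol : ∀ t < T, IsPolicy (pol t)) (hπ : IsPolicy π)
    (hz : ∀ t < T, norm1inf (mdVec T δ ℓ h (g t) t) ≤ κ) :
    regretMD T δ ℓ p ρ h pol g π ≤ 2 * κ * T := by
  refine (sum_le_sum fun t ht => pairing_mdVec_le hp hρ hpol hπ (mem_range.1 ht)
    (hz t (mem_range.1 ht))).trans_eq ?_
  rw [sum_const, card_range, nsmul_eq_mul, mul_comm]

lemma mul_pairing_mdVec_le [Nonempty X] (hp : IsKernel p) (hρ : ρ ∈ stdSimplex ℝ (X × A))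
    (hpol : ∀ t < T, IsPolicy (pol t)) (hπ : IsPolicy π) (hη : 0 ≤ η)
    (hrule : FollowsRule D T δ ℓ α η p ρ h pol g)
    (hreg : ∀ t < T, D.Regular (iterate p ρ h pol t) (pol t))
    (hfeas : ∀ t < T, occ (empKernel h t) π (initDist p ρ pol t) ∈
      constraintSet T δ α ρ (initDist p ρ pol t) h t)
    (hz : norm1inf (mdVec T δ ℓ h (g t) t) ≤ κ) (ht : t + 1 < T) :
    η * pairing (mdVec T δ ℓ h (g t) t)
        (iterate p ρ h pol t - occ (empKernel h t) π (initDist p ρ pol t)) ≤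
      pairing (D.grad (iterate p ρ h pol (t + 1)) (pol (t + 1)) -
          D.grad (iterate p ρ h pol t) (pol t))
        (occ (empKernel h (t + 1)) π (initDist p ρ pol (t + 1))) +
      (η * κ) ^ 2 + 2 * (η * κ) * drift p ρ h pol t := by
  have ht' := t.lt_succ_self.trans ht
  have hν := initDist_mem_stdSimplex hp hρ hpol ht.le
  obtain ⟨hmem, hmin⟩ := hrule t ht (hreg t ht') ⟨_, hfeas (t + 1) ht⟩
  exact mirror_descent_step (isKernel_empKernel h t) (isKernel_empKernel h (t + 1)) (hpol t ht')
    (hpol (t + 1) ht) hπ (initDist_mem_stdSimplex hp hρ hpol ht'.le) hν (hreg t ht')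
    (hreg (t + 1) ht) (convex_constraintSet T δ α ρ _ h (t + 1)) hmem (hfeas (t + 1) ht) hmin hη
    hz (drift_nonneg p ρ h pol t) fun _ hτ => l1_occ_succ_sub_le_drift hτ hν

lemma regretMD_le [Nonempty X] (hp : IsKernel p) (hρ : ρ ∈ stdSimplex ℝ (X × A))
    (hpol : ∀ t < T, IsPolicy (pol t)) (hπ : IsPolicy π) (hT : 1 ≤ T) (hη : 0 < η)
    (hrule : FollowsRule D T δ ℓ α η p ρ h pol g)
    (hreg : ∀ t < T, D.Regular (iterate p ρ h pol t) (pol t))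
    (hgrad : ∀ t < T, norm1inf (D.grad (iterate p ρ h pol t) (pol t)) ≤ Ψ)
    (hfeas : ∀ t < T, occ (empKernel h t) π (initDist p ρ pol t) ∈
      constraintSet T δ α ρ (initDist p ρ pol t) h t)
    (hz : ∀ t < T, norm1inf (mdVec T δ ℓ h (g t) t) ≤ κ) :
    regretMD T δ ℓ p ρ h pol g π ≤ Ψ * (∑ t ∈ range T, drift p ρ h pol t + 2) / η +
      T * (η * κ ^ 2) + 2 * κ * (∑ t ∈ range T, drift p ρ h pol t + 1) := by
  obtain ⟨n, rfl⟩ := Nat.exists_eq_add_of_le' hT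
  have hκ : 0 ≤ κ := (norm1inf_nonneg _).trans (hz 0 hT)
  have hΨ : 0 ≤ Ψ := (norm1inf_nonneg _).trans (hgrad 0 hT)
  have hν (t : ℕ) (ht : t < n + 1) := initDist_mem_stdSimplex hp hρ hpol ht.le
  set V := ∑ t ∈ range n, drift p ρ h pol t
  have hV : V ≤ ∑ t ∈ range (n + 1), drift p ρ h pol t :=
    (sum_range_succ (drift p ρ h pol) n).symm ▸ le_add_of_nonneg_right (drift_nonneg p ρ h pol n)
  have hgradients := sum_pairing_sub_succ_le (n := n) (d := drift p ρ h pol)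
    (G := fun t => D.grad (iterate p ρ h pol t) (pol t))
    (c := fun t => occ (empKernel h t) π (initDist p ρ pol t))
    (fun t ht => hgrad t (Nat.lt_succ_of_le ht))
    (fun t ht i => (l1_of_mem_stdSimplex (occ_mem_stdSimplex (isKernel_empKernel h t) hπ
      (hν t (Nat.lt_succ_of_le ht)) _)).le)
    (fun t ht => ⟨drift_nonneg p ρ h pol t, fun i =>
      l1_occ_succ_sub_le_drift hπ (hν (t + 1) (Nat.succ_lt_succ ht)) i.succ⟩)
  have hsteps := sum_le_sum fun t ht => mul_pairing_mdVec_le hp hρ hpol hπ hη.le hrule hreg hfeas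
    (hz t ((mem_range.1 ht).trans n.lt_succ_self)) (Nat.succ_lt_succ (mem_range.1 ht))
  rw [← mul_sum, sum_add_distrib, sum_add_distrib, ← mul_sum, sum_const, card_range,
    nsmul_eq_mul] at hsteps
  have hlast := pairing_mdVec_le hp hρ hpol hπ n.lt_succ_self (hz n n.lt_succ_self)
  have hdiv : regretMD (n + 1) δ ℓ p ρ h pol g π - 2 * κ ≤
      (Ψ * (V + 2) + n * (η * κ) ^ 2 + 2 * (η * κ) * V) / η := by
    rw [le_div_iff₀' hη, regretMD, sum_range_succ]
    nlinarith
  calc regretMD (n + 1) δ ℓ p ρ h pol g π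
      ≤ (Ψ * (V + 2) + n * (η * κ) ^ 2 + 2 * (η * κ) * V) / η + 2 * κ := by linarith
    _ = Ψ * (V + 2) / η + n * (η * κ ^ 2) + 2 * κ * (V + 1) := by field_simp; ring
    _ ≤ _ := by gcongr; exact n.le_succ

end Regret

section Tuning

lemma le_of_tuned_step {R κ Ψ V W T : ℝ} (hκ : 0 < κ) (hΨ : 1 / 16 ≤ Ψ) (hT : 0 < T)
    (hW : 0 < W) (hVW : V ≤ W)
    (htuned : R ≤ Ψ * V / (√(Ψ * W / T) / κ) + T * (√(Ψ * W / T) / κ * κ ^ 2) + 2 * κ * V)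
    (htrivial : R ≤ 2 * κ * T) : R ≤ 10 * (κ * √(Ψ * W * T)) := by
  set q := √(Ψ * W / T)
  have hq : 0 < q := Real.sqrt_pos.2 (by positivity)
  have hq2 : q ^ 2 = Ψ * W / T := Real.sq_sqrt (by positivity)
  have hroot : √(Ψ * W * T) = q * T := by
    rw [Real.sqrt_eq_iff_mul_self_eq (by positivity) (by positivity), mul_mul_mul_comm, ← sq q, hq2]
    field_simp
  have hmin : min W T ≤ 4 * √(Ψ * W * T) := by
    have hWT : √(W * T) ≤ √(4 ^ 2 * (Ψ * W * T)) :=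
      Real.sqrt_le_sqrt (by nlinarith [mul_pos hW hT])
    rw [Real.sqrt_mul (x := 4 ^ 2) (by positivity), Real.sqrt_sq (by positivity)] at hWT
    refine le_trans (Real.le_sqrt_of_sq_le ?_) hWT
    rw [sq]
    exact mul_le_mul (min_le_left _ _) (min_le_right _ _) (le_min hW.le hT.le) hW.le
  have hbalanced : Ψ * W / (q / κ) + T * (q / κ * κ ^ 2) = 2 * (κ * √(Ψ * W * T)) := by
    have hΨW : Ψ * W = q ^ 2 * T := by rw [hq2, div_mul_cancel₀ _ hT.ne']
    rw [hroot, hΨW]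
    field_simp
    ring
  have hmono : Ψ * V / (q / κ) + 2 * κ * V ≤ Ψ * W / (q / κ) + 2 * κ * W := by gcongr
  rcases min_cases W T with ⟨hWT, -⟩ | ⟨hWT, -⟩ <;> rw [hWT] at hmin <;> nlinarith

lemma sqrt_mul_sqrt_eq_rpow {s a t : ℝ} (hs : 0 < s) (ha : 0 ≤ a) (ht : 0 < t) :
    √s * √(s * √(s * a * t) * t) = s ^ (5 / 4 : ℝ) * a ^ (1 / 4 : ℝ) * t ^ (3 / 4 : ℝ) := by
  have hroot : √√(s * a * t) = s ^ (1 / 4 : ℝ) * a ^ (1 / 4 : ℝ) * t ^ (1 / 4 : ℝ) := by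
    rw [Real.sqrt_eq_rpow, Real.sqrt_eq_rpow, ← Real.rpow_mul (by positivity),
      Real.mul_rpow (by positivity) ht.le, Real.mul_rpow hs.le ha]
    norm_num
  have hs54 : s ^ (5 / 4 : ℝ) = s * s ^ (1 / 4 : ℝ) := by
    rw [← Real.rpow_one_add' hs.le (by norm_num)]
    norm_num
  have ht34 : t ^ (3 / 4 : ℝ) = √t * t ^ (1 / 4 : ℝ) := by
    rw [Real.sqrt_eq_rpow, ← Real.rpow_add ht]
    norm_num
  rw [Real.sqrt_mul (by positivity), Real.sqrt_mul hs.le, hroot, hs54, ht34]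
  linear_combination (s ^ (1 / 4 : ℝ) * a ^ (1 / 4 : ℝ) * t ^ (1 / 4 : ℝ) * √t) *
    Real.mul_self_sqrt hs.le

variable (X A : Type*) [Fintype X] [Fintype A] (N T : ℕ) (ℓ α Ψ δ : ℝ)

/-- The high-probability bound on the total drift of the estimated models. -/
noncomputable def driftBound : ℝ :=
  15 ^ 2 * ((N : ℝ) ^ 2 * Fintype.card X * logFactor X A N T δ ^ 2 *
    √((Fintype.card X : ℝ) * Fintype.card A * T)) / (1 - α)

/-- The step size that balances the two terms `Ψ driftBound / η` and `T η mdVecBound²` of the regret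
of mirror descent. Where this quotient vanishes, in particular for `ℓ = 0`, any positive number
will do. -/
noncomputable def stepSize : ℝ :=
  let s := √(Ψ * driftBound X A N T α δ / T) / mdVecBound X A N T δ ℓ
  if 0 < s then s else 1

lemma stepSize_pos : 0 < stepSize X A N T ℓ α Ψ δ := by
  dsimp only [stepSize]
  split_ifs with hs
  exacts [hs, one_pos]

variable {X A N T ℓ α Ψ δ}

lemma one_le_sqrt_card_mul [Nonempty X] [Nonempty A] (hT : 1 ≤ T) :
    1 ≤ √((Fintype.card X : ℝ) * Fintype.card A * T) := by
  rw [Real.one_le_sqrt]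
  exact_mod_cast one_le_mul (one_le_mul Fintype.card_pos Fintype.card_pos) hT

lemma driftBound_pos [Nonempty X] [Nontrivial A] (hN : 1 ≤ N) (hT : 1 ≤ T) (hα : α < 1)
    (hδ0 : 0 < δ) (hδ1 : δ < 1) : 0 < driftBound X A N T α δ := by
  have hΛ : 0 < logFactor X A N T δ :=
    one_half_pos.trans_le (half_le_logFactor hN hT hδ0 hδ1)
  exact div_pos (by positivity) (sub_pos.2 hα)

lemma mul_sqrt_card_le [Nonempty X] [Nontrivial A] (hN : 1 ≤ N) (hT : 1 ≤ T) (hδ0 : 0 < δ)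
    (hδ1 : δ < 1) :
    N * √((Fintype.card X : ℝ) * Fintype.card A * T) ≤
      4 * ((N : ℝ) ^ 2 * Fintype.card X * logFactor X A N T δ ^ 2 *
        √((Fintype.card X : ℝ) * Fintype.card A * T)) := by
  have hX : (1 : ℝ) ≤ Fintype.card X := by exact_mod_cast Fintype.card_pos
  have hN1 : (1 : ℝ) ≤ N := by exact_mod_cast hN
  have hΛ : 1 ≤ 4 * logFactor X A N T δ ^ 2 := by
    nlinarith [half_le_logFactor (X := X) (A := A) hN hT hδ0 hδ1]
  have hfactor : 1 ≤ N * Fintype.card X * (4 * logFactor X A N T δ ^ 2) :=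
    one_le_mul_of_one_le_of_one_le (one_le_mul_of_one_le_of_one_le hN1 hX) hΛ
  refine (le_mul_of_one_le_right (by positivity) hfactor).trans_eq ?_
  ring

-- `C_δ² = 2 |X| log`, and both `2` and `log (1 / δ)` are absorbed in the leading terms.
lemma mul_expBonuses_le [Nonempty X] [Nontrivial A] (hN : 1 ≤ N) (hT : 1 ≤ T) (hδ0 : 0 < δ)
    (hδ1 : δ < 1) :
    (2 + N * bonusConst X A N T δ) * (bonusConst X A N T δ *
        (2 * N * (3 * √((Fintype.card X : ℝ) * Fintype.card A * T) + Real.log (1 / δ)))) ≤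
      84 * ((N : ℝ) ^ 2 * Fintype.card X * logFactor X A N T δ ^ 2 *
        √((Fintype.card X : ℝ) * Fintype.card A * T)) := by
  have hΛ := half_le_logFactor (X := X) (A := A) hN hT hδ0 hδ1
  have hC := one_le_bonusConst (X := X) (A := A) hN hT hδ0 hδ1
  have hCsq : bonusConst X A N T δ ^ 2 = 2 * (Fintype.card X * logFactor X A N T δ) := by
    rw [bonusConst_eq_sqrt, Real.sq_sqrt (by positivity)]
  have hlog := log_one_div_le_logFactor (X := X) (A := A) hN hT hδ0
  have hQ := one_le_sqrt_card_mul (X := X) (A := A) hT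
  set Λ := logFactor X A N T δ
  set C := bonusConst X A N T δ
  set Q := √((Fintype.card X : ℝ) * Fintype.card A * T)
  have hlog0 : 0 ≤ Real.log (1 / δ) := Real.log_nonneg ((one_le_div hδ0).2 hδ1.le)
  have hQΛ : 3 * Q + Real.log (1 / δ) ≤ 7 * (Q * Λ) := by nlinarith
  have hNC : 1 ≤ N * C := one_le_mul_of_one_le_of_one_le (by exact_mod_cast hN) hC
  calc (2 + N * C) * (C * (2 * N * (3 * Q + Real.log (1 / δ))))
      ≤ (3 * (N * C)) * (C * (2 * N * (7 * (Q * Λ)))) := by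
        gcongr
        linarith
    _ = 42 * (N ^ 2 * (Q * Λ)) * C ^ 2 := by ring
    _ = 84 * (N ^ 2 * Fintype.card X * Λ ^ 2 * Q) := by rw [hCsq]; ring

variable {p : Fin N → X × A → X → ℝ} {ρ : X × A → ℝ} {h : ℕ → Fin (N + 1) → X × A}
  {pol : ℕ → Fin N → X → A → ℝ}

lemma sum_drift_add_two_le [Nonempty X] [Nontrivial A] (hp : IsKernel p)
    (hρ : ρ ∈ stdSimplex ℝ (X × A)) (hpol : ∀ t < T, IsPolicy (pol t)) (hN : 1 ≤ N) (hT : 1 ≤ T)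
    (hα0 : 0 ≤ α) (hα1 : α < 1) (hδ0 : 0 < δ) (hδ1 : δ < 1) (hker : KernelsWithinBonus T δ p h)
    (hexp : ExpBonusesBounded T δ p ρ h pol)
    (hmem : ∀ t, t + 1 < T → iterate p ρ h pol (t + 1) ∈
      constraintSet T δ α ρ (initDist p ρ pol (t + 1)) h (t + 1)) :
    ∑ t ∈ range T, drift p ρ h pol t + 2 ≤ driftBound X A N T α δ := by
  have hdrift := sum_drift_le (h := h) hα0 hα1 fun t ht =>
    l1_initDist_succ_sub_le hp hρ hpol hα0 hker hmem ht
  rw [sum_add_distrib, ← mul_sum, ← mul_sum, sum_ite_eq' (range T) 0,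
    if_pos (mem_range.2 hT)] at hdrift
  have hC : 0 ≤ bonusConst X A N T δ := Real.sqrt_nonneg _
  have hbonuses := (mul_le_mul_of_nonneg_left (mul_le_mul_of_nonneg_left hexp hC)
    (by positivity)).trans (mul_expBonuses_le (X := X) (A := A) hN hT hδ0 hδ1)
  have hQ := one_le_sqrt_card_mul (X := X) (A := A) hT
  have hscale := mul_sqrt_card_le (X := X) (A := A) hN hT hδ0 hδ1
  have hN1 : (1 : ℝ) ≤ N := by exact_mod_cast hN
  unfold driftBound
  set u := (N : ℝ) ^ 2 * Fintype.card X * logFactor X A N T δ ^ 2 *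
    √((Fintype.card X : ℝ) * Fintype.card A * T)
  set Q := √((Fintype.card X : ℝ) * Fintype.card A * T)
  have hα' : 0 < 1 - α := sub_pos.2 hα1
  have hNQ : 1 ≤ N * Q := one_le_mul_of_one_le_of_one_le hN1 hQ
  have hu : u ≤ u / (1 - α) := le_div_self (by linarith) hα' (by linarith)
  have hsum := div_le_div_of_nonneg_right (add_le_add_left hbonuses (2 : ℝ)) hα'.le
  have htwo : 84 * u + 2 ≤ 92 * u := by linarith
  have hquot := hsum.trans (div_le_div_of_nonneg_right htwo hα'.le)
  rw [mul_div_assoc] at hquot ⊢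
  linarith

lemma mdVecBound_mul_sqrt_le [Nonempty X] [Nontrivial A] (hN : 1 ≤ N) (hT : 1 ≤ T) (hℓ : 0 ≤ ℓ)
    (hα : α < 1) (hΨ : 0 ≤ Ψ) (hδ0 : 0 < δ) (hδ1 : δ < 1) :
    mdVecBound X A N T δ ℓ * √(Ψ * driftBound X A N T α δ * T) ≤
      30 * (ℓ * (N : ℝ) ^ 3 * (Fintype.card X : ℝ) ^ (5 / 4 : ℝ) *
        (Fintype.card A : ℝ) ^ (1 / 4 : ℝ) * √(Ψ / (1 - α)) * (T : ℝ) ^ (3 / 4 : ℝ)) *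
        logFactor X A N T δ ^ 2 := by
  have hΛ := half_le_logFactor (X := X) (A := A) hN hT hδ0 hδ1
  have hpow := sqrt_mul_sqrt_eq_rpow (s := Fintype.card X) (a := Fintype.card A) (t := T)
    (by exact_mod_cast Fintype.card_pos) (Nat.cast_nonneg _) (by exact_mod_cast hT)
  have hC : bonusConst X A N T δ ≤ 2 * logFactor X A N T δ * √(Fintype.card X) := by
    rw [bonusConst_eq_sqrt, ← Real.sqrt_sq (by linarith : 0 ≤ 2 * logFactor X A N T δ),
      ← Real.sqrt_mul (sq_nonneg _)]
    refine Real.sqrt_le_sqrt ?_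
    have hX : (0 : ℝ) ≤ Fintype.card X := Nat.cast_nonneg _
    nlinarith [mul_nonneg hX (mul_nonneg (by linarith : 0 ≤ logFactor X A N T δ)
      (by linarith : 0 ≤ 2 * logFactor X A N T δ - 1))]
  unfold mdVecBound driftBound
  set Λ := logFactor X A N T δ
  set Q := √((Fintype.card X : ℝ) * Fintype.card A * T)
  have hroot : √(Ψ * (15 ^ 2 * ((N : ℝ) ^ 2 * Fintype.card X * Λ ^ 2 * Q) / (1 - α)) * T) =
      15 * N * Λ * (√(Ψ / (1 - α)) * √(Fintype.card X * Q * T)) := by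
    rw [← Real.sqrt_mul (by positivity), ← Real.sqrt_sq (by positivity : 0 ≤ 15 * N * Λ),
      ← Real.sqrt_mul (sq_nonneg _)]
    congr 1
    ring
  rw [hroot]
  calc N * (ℓ * (N * bonusConst X A N T δ)) *
        (15 * N * Λ * (√(Ψ / (1 - α)) * √(Fintype.card X * Q * T)))
      ≤ N * (ℓ * (N * (2 * Λ * √(Fintype.card X)))) *
        (15 * N * Λ * (√(Ψ / (1 - α)) * √(Fintype.card X * Q * T))) := by gcongr
    _ = 30 * (ℓ * N ^ 3 * √(Ψ / (1 - α))) *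
          (√(Fintype.card X) * √(Fintype.card X * Q * T)) * Λ ^ 2 := by ring
    _ = _ := by rw [hpow]; ring

end Tuning

section Rate

variable {X A : Type*} [Fintype X] [Fintype A] {N T : ℕ} {δ ℓ α Ψ : ℝ}
  {p : Fin N → X × A → X → ℝ} {ρ : X × A → ℝ} {h : ℕ → Fin (N + 1) → X × A}
  {pol : ℕ → Fin N → X → A → ℝ} {π : Fin N → X → A → ℝ} {D : Div} {g : ℕ → Fin N → X × A → ℝ}

lemma regretMD_eq_zero [Subsingleton A] (hpol : ∀ t < T, IsPolicy (pol t)) (hπ : IsPolicy π) :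
    regretMD T δ ℓ p ρ h pol g π = 0 := by
  refine sum_eq_zero fun t ht => ?_
  have hpolicy : pol t = π := funext₂ fun i x =>
    eq_of_mem_stdSimplex_of_subsingleton (hpol t (mem_range.1 ht) i x) (hπ i x)
  rw [iterate, hpolicy, pairing_sub, sub_self]

lemma regretMD_le_mul_sqrt [Nonempty X] [Nontrivial A] (hp : IsKernel p)
    (hρ : ρ ∈ stdSimplex ℝ (X × A)) (hcontr : Contracts p ρ α) (hpol : ∀ t < T, IsPolicy (pol t))
    (hπ : IsPeriodic p ρ π) (hN : 1 ≤ N) (hT : 1 ≤ T) (hℓ : 0 ≤ ℓ) (hα0 : 0 ≤ α) (hα1 : α < 1)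
    (hδ0 : 0 < δ) (hδ1 : δ < 1) (hker : KernelsWithinBonus T δ p h)
    (hexp : ExpBonusesBounded T δ p ρ h pol)
    (hrule : FollowsRule D T δ ℓ α (stepSize X A N T ℓ α Ψ δ) p ρ h pol g)
    (hreg : ∀ t < T, D.Regular (iterate p ρ h pol t) (pol t))
    (hgrad : ∀ t < T, norm1inf (D.grad (iterate p ρ h pol t) (pol t)) ≤ Ψ)
    (hg : ∀ t < T, ∀ i y, |g t i y| ≤ ℓ) :
    regretMD T δ ℓ p ρ h pol g π ≤
      10 * (mdVecBound X A N T δ ℓ * √(Ψ * driftBound X A N T α δ * T)) := by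
  have hz (t : ℕ) (ht : t < T) :=
    norm1inf_mdVec_le (one_le_bonusConst hN hT hδ0 hδ1) hℓ (hg t ht) h t
  have htrivial := regretMD_le_two_mul hp hρ hpol hπ.1 hz
  rcases (mdVecBound_nonneg (X := X) (A := A) (N := N) (T := T) (δ := δ) hℓ).eq_or_lt
    with hκ | hκ
  · simpa [← hκ] using htrivial
  have hν (t : ℕ) (ht : t < T) := initDist_mem_stdSimplex hp hρ hpol ht.le
  have hΨ : 1 / 16 ≤ Ψ := (le_norm1inf_grad (isKernel_empKernel h 0) (hpol 0 hT) (hν 0 hT) hN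
    (hreg 0 hT)).trans (hgrad 0 hT)
  have hfeas (t : ℕ) (ht : t < T) := occ_mem_constraintSet hp hρ hcontr hπ (hν t ht) (hker t ht)
  have hT0 : (0 : ℝ) < T := by exact_mod_cast hT
  have hW := driftBound_pos (X := X) (A := A) hN hT hα1 hδ0 hδ1
  have hdrift := sum_drift_add_two_le hp hρ hpol hN hT hα0 hα1 hδ0 hδ1 hker hexp fun t ht =>
    (hrule t ht (hreg t (t.lt_succ_self.trans ht)) ⟨_, hfeas (t + 1) ht⟩).1
  have hregret := regretMD_le hp hρ hpol hπ.1 hT (stepSize_pos X A N T ℓ α Ψ δ) hrule hreg hgrad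
    hfeas hz
  rw [stepSize, if_pos (by positivity)] at hregret
  refine le_of_tuned_step hκ hΨ hT0 hW hdrift (hregret.trans ?_) htrivial
  gcongr
  exact one_le_two

lemma regretMD_le_rate [Nonempty X] [Nontrivial A] (hp : IsKernel p)
    (hρ : ρ ∈ stdSimplex ℝ (X × A)) (hcontr : Contracts p ρ α) (hpol : ∀ t < T, IsPolicy (pol t))
    (hπ : IsPeriodic p ρ π) (hN : 1 ≤ N) (hT : 1 ≤ T) (hℓ : 0 ≤ ℓ) (hα0 : 0 ≤ α) (hα1 : α < 1)
    (hδ0 : 0 < δ) (hδ1 : δ < 1) (hker : KernelsWithinBonus T δ p h)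
    (hexp : ExpBonusesBounded T δ p ρ h pol)
    (hrule : FollowsRule D T δ ℓ α (stepSize X A N T ℓ α Ψ δ) p ρ h pol g)
    (hreg : ∀ t < T, D.Regular (iterate p ρ h pol t) (pol t))
    (hgrad : ∀ t < T, norm1inf (D.grad (iterate p ρ h pol t) (pol t)) ≤ Ψ)
    (hg : ∀ t < T, ∀ i y, |g t i y| ≤ ℓ) :
    regretMD T δ ℓ p ρ h pol g π ≤
      300 * (ℓ * (N : ℝ) ^ 3 * (Fintype.card X : ℝ) ^ (5 / 4 : ℝ) *
        (Fintype.card A : ℝ) ^ (1 / 4 : ℝ) * √(Ψ / (1 - α)) * (T : ℝ) ^ (3 / 4 : ℝ)) *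
        logFactor X A N T δ ^ 2 := by
  have hΨ : 0 ≤ Ψ := (norm1inf_nonneg _).trans (hgrad 0 hT)
  linarith [regretMD_le_mul_sqrt hp hρ hcontr hpol hπ hN hT hℓ hα0 hα1 hδ0 hδ1 hker hexp hrule hreg
    hgrad hg, mdVecBound_mul_sqrt_le (X := X) (A := A) hN hT hℓ hα1 hΨ hδ0 hδ1]

end Rate

end PeriodicMDP

theorem mainTheorem4 :
    ∃ (C : ℝ) (k : ℕ), 0 < C ∧
      ∀ (X A : Type*) [Fintype X] [Nonempty X] [Fintype A] [Nonempty A] (D : PeriodicMDP.Div)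
        (N T : ℕ) (ℓ α Ψ δ : ℝ), 1 ≤ N → 1 ≤ T → 0 ≤ ℓ → 0 ≤ α → α < 1 → 0 ≤ Ψ → 0 < δ → δ < 1 →
      ∃ η : ℝ, 0 < η ∧
      ∀ (p : Fin N → X × A → X → ℝ) (ρ : X × A → ℝ),
        PeriodicMDP.IsKernel p → ρ ∈ stdSimplex ℝ (X × A) → PeriodicMDP.Contracts p ρ α →
      ∀ (Ω : Type*) [mΩ : MeasurableSpace Ω] (P : MeasureTheory.Measure Ω)
        [MeasureTheory.IsProbabilityMeasure P] (ℱ : MeasureTheory.Filtration ℕ mΩ)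
        (traj : ℕ → Ω → Fin (N + 1) → X × A) (pol : ℕ → Ω → Fin N → X → A → ℝ)
        (f : ℕ → Ω → Fin N → (X × A → ℝ) → ℝ) (g : ℕ → Ω → Fin N → X × A → ℝ),
        PeriodicMDP.IsObservation P ℱ T p ρ traj pol →
        (∀ ω, PeriodicMDP.IsLoss ℓ T (fun t => f t ω)) →
        (∀ ω, ∀ t < T, ∀ i : Fin N, PeriodicMDP.IsSubgradient (f t ω i)
          (PeriodicMDP.iterate p ρ (fun s => traj s ω) (fun s => pol s ω) t i.succ) (g t ω i)) →
        (∀ ω, PeriodicMDP.FollowsRule D T δ ℓ α η p ρ (fun s => traj s ω) (fun s => pol s ω)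
          (fun s => g s ω)) →
      ∃ E : Set Ω, MeasurableSet E ∧ ENNReal.ofReal (1 - 3 * δ) ≤ P E ∧
        ∀ ω ∈ E,
          (∀ t < T,
            D.Regular (PeriodicMDP.iterate p ρ (fun s => traj s ω) (fun s => pol s ω) t)
              (pol t ω) ∧
            PeriodicMDP.norm1inf
              (D.grad (PeriodicMDP.iterate p ρ (fun s => traj s ω) (fun s => pol s ω) t)
                (pol t ω)) ≤ Ψ) →
          ∀ π, PeriodicMDP.IsPeriodic p ρ π →
            PeriodicMDP.regretMD T δ ℓ p ρ (fun s => traj s ω) (fun s => pol s ω)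
              (fun s => g s ω) π ≤
            C * (ℓ * (N : ℝ) ^ 3 * (Fintype.card X : ℝ) ^ (5 / 4 : ℝ) *
              (Fintype.card A : ℝ) ^ (1 / 4 : ℝ) * √(Ψ / (1 - α)) * (T : ℝ) ^ (3 / 4 : ℝ)) *
              Real.log ((Fintype.card X : ℝ) * (Fintype.card A : ℝ) * (N : ℝ) * (T : ℝ) / δ) ^ k := by
  refine ⟨300, 2, by norm_num, ?_⟩
  intro X A _ _ _ _ D N T ℓ α Ψ δ hN hT hℓ hα0 hα1 _ hδ0 hδ1
  refine ⟨PeriodicMDP.stepSize X A N T ℓ α Ψ δ, PeriodicMDP.stepSize_pos X A N T ℓ α Ψ δ, ?_⟩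
  intro p ρ hp hρ hcontr Ω _ P _ ℱ traj pol f g hobs hf hg hrule
  have hpol (ω : Ω) : ∀ t < T, PeriodicMDP.IsPolicy (pol t ω) := fun t ht => hobs.isPolicy t ht ω
  have hg_le (ω : Ω) : ∀ t < T, ∀ i y, |g t ω i y| ≤ ℓ := fun t ht i =>
    (hg ω t ht i).abs_le (hf ω t ht i).2
  rcases subsingleton_or_nontrivial A with _ | _
  · refine ⟨Set.univ, MeasurableSet.univ, ?_, fun ω _ _ π hπ => ?_⟩
    · rw [measure_univ, ENNReal.ofReal_le_one]
      linarith
    · rw [PeriodicMDP.regretMD_eq_zero (hpol ω) hπ.1]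
      positivity
  · obtain ⟨E, hE, hPE, hgood⟩ := PeriodicMDP.exists_goodEvent hp hρ hobs hN hT hδ0 hδ1
    refine ⟨E, hE, hPE, fun ω hω hgrad π hπ => ?_⟩
    exact PeriodicMDP.regretMD_le_rate hp hρ hcontr (hpol ω) hπ hN hT hℓ hα0 hα1 hδ0 hδ1
      (hgood ω hω).1 (hgood ω hω).2 (hrule ω) (fun t ht => (hgrad t ht).1)
      (fun t ht => (hgrad t ht).2) (hg_le ω)
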